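/- **Theorem (Rational Subsets Distance Problem in free groups).** Let $F$ be the free group with finite basis $X=\{x_0,\dots,x_{n-1}\}$, $n\ge 0$, and let $d(g,h)=|g^{-1}h|$ be the word metric on $F$ relative to $X$, where $|g|$ is the length of a shortest word in $X\cup X^{-1}$ representing $g$. A finite deterministic automaton over $X\cup X^{-1}$ has finitely many states, one initial state, a set of accepting states and, for every state and every letter, at most one transition; it gives the rational subset of $F$ consisting of all elements represented by the (not necessarily reduced) words that it accepts. There is a Turing machine which, given two finite deterministic automata over $X\cup X^{-1}$ (as transition tables) that give the rational subsets $R$ and $S$ of $F$, works in time bounded by a polynomial in the size of the input and does the following: if $R$ or $S$ is empty, it reports that there is no pair; otherwise it outputs two words in $X\cup X^{-1}$ that represent elements $r\in R$ and $s\in S$ with a shortest distance apart, that is, with $d(r,s)\le d(r',s')$ for all $r'\in R$ and $s'\in S$. -/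

import Mathlib

/-- A group word over the basis `x₀, …, x₍ₙ₋₁₎` of the free group of rank `n`: a list of letters,
where `(i, true)` stands for `xᵢ` and `(i, false)` for `xᵢ⁻¹`. Words need not be reduced; the word
`w` represents the group element `FreeGroup.mk w`. -/
abbrev GroupWord (n : ℕ) : Type := List (Fin n × Bool)

/-- The word metric on the free group of rank `n` relative to its basis: `d(g, h) = |g⁻¹ h|`, where
`|g|` is the length of a shortest word representing `g`, that is, of its reduced word. -/
def wordDist {n : ℕ} (g h : FreeGroup (Fin n)) : ℕ := (g⁻¹ * h).norm

/-- `FreeGroup.norm g` is the length of a shortest word representing `g`. -/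
theorem isLeast_norm {n : ℕ} (g : FreeGroup (Fin n)) :
    IsLeast {l | ∃ w : GroupWord n, FreeGroup.mk w = g ∧ w.length = l} g.norm := by
  refine ⟨⟨g.toWord, FreeGroup.mk_toWord, rfl⟩, ?_⟩
  rintro l ⟨w, rfl, rfl⟩
  exact FreeGroup.norm_mk_le

/-- A finite deterministic automaton over the alphabet `{x₀^±1, …, x₍ₙ₋₁₎^±1}`: finitely many
states, one initial state, any set of accepting states, and for every state and every letter at
most one transition (Mathlib's `DFA` would insist on exactly one). -/
structure DetAutomaton (n : ℕ) where
  /-- the number of states; the states are the elements of `Fin states` -/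
  states : ℕ
  /-- the initial state -/
  start : Fin states
  /-- the accepting states -/
  accept : Fin states → Bool
  /-- the partial transition function -/
  step : Fin states → Fin n × Bool → Option (Fin states)

namespace DetAutomaton

variable {n : ℕ}

/-- The word `w` is accepted: it can be read from the initial state and leads to an accepting
state. -/
def Accepts (A : DetAutomaton n) (w : GroupWord n) : Prop :=
  ∃ q : Fin A.states, w.foldlM A.step A.start = some q ∧ A.accept q = true

/-- The rational subset of the free group given by `A`: all elements that are represented by some
word (reduced or not) accepted by `A`. -/
def rationalSubset (A : DetAutomaton n) : Set (FreeGroup (Fin n)) :=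
  FreeGroup.mk '' {w | A.Accepts w}

/-- The table of `A`: the number of states, the initial state, and then for every state `p` the bit
telling whether `p` is accepting, followed, for every letter, by `0` if there is no transition from
`p` with this letter and by `q + 1` if there is one and it leads to `q`. -/
def table (A : DetAutomaton n) : List ℕ :=
  A.states :: (A.start : ℕ) ::
    (List.finRange A.states).flatMap fun p =>
      (A.accept p).toNat ::
        ((List.finRange n).flatMap fun i => [(i, true), (i, false)]).map fun a =>
          match A.step p a with
          | none => 0
          | some q => (q : ℕ) + 1

end DetAutomaton

/-- A list of natural numbers as a bit string: every number in unary, ended by a `false`. -/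
def encodeNats (l : List ℕ) : List Bool :=
  l.flatMap fun m => List.replicate m true ++ [false]

/-- An input, a pair of automata, as a bit string: the table of the first one, then that of the
second one. (An automaton with `k` states has a table with more than `k` entries, each of them at
most `k`, so that unary numbers are as good as binary ones up to a polynomial.) -/
def encodeInput {n : ℕ} (x : DetAutomaton n × DetAutomaton n) : List Bool :=
  encodeNats (x.1.table ++ x.2.table)

/-- An output as a string over the letters and one additional symbol `none`: the empty string for
the answer "there is no such pair", and `u none v` for the pair of words `(u, v)`. -/
def encodeOutput {n : ℕ} : Option (GroupWord n × GroupWord n) → List (Option (Fin n × Bool))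
  | none => []
  | some (u, v) => u.map some ++ none :: v.map some

/-- Correct answers to the rational subsets distance problem for the rational subsets given by two
automata: the answer "there is no pair" is correct if one of the two sets is empty, and a pair of
words is correct if they represent elements of the first and of the second set with a shortest
distance apart. -/
def IsClosestPair {n : ℕ} (x : DetAutomaton n × DetAutomaton n) :
    Option (GroupWord n × GroupWord n) → Prop
  | none => x.1.rationalSubset = ∅ ∨ x.2.rationalSubset = ∅
  | some (u, v) =>
      FreeGroup.mk u ∈ x.1.rationalSubset ∧ FreeGroup.mk v ∈ x.2.rationalSubset ∧
        ∀ r ∈ x.1.rationalSubset, ∀ s ∈ x.2.rationalSubset,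
          wordDist (FreeGroup.mk u) (FreeGroup.mk v) ≤ wordDist r s

/-- The search problem "given `a`, find some `b` with `P a b`" is solvable in polynomial time, for
inputs and outputs presented as strings: a (multi-stack) Turing machine computes a solution of every
instance `a`, in a number of steps bounded by a polynomial in the length of the string for `a`. -/
def SolvableInPolyTime {α β αΓ βΓ : Type} (ea : α → List αΓ) (eb : β → List βΓ)
    (P : α → β → Prop) : Prop :=
  ∃ f : α → β, (∀ a, P a (f a)) ∧ Nonempty (Turing.TM2ComputableInPolyTime ea eb f)

/-! The proof has two halves: an algorithm with its correctness, and its realization in polynomial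
time on a multi-stack machine.

The algorithm starts from Benois' saturation. Both automata are put into one graph. From the
diagonal, pairs of states are generated by composition and by enclosing a pair between an edge
labelled x and an edge labelled x⁻¹; all pairs obtained are joined by a path with trivial label. If
edges may be preceded by such a pair, and acceptance may be reached through one, then a factor x x⁻¹
can be deleted from any readable word (`reads_cancel`). Hence the reduced word of every element of R
or S is readable (`reads_toWord`), and conversely every readable word represents an element of the
set (`mk_mem_elements_of_reads`).

The reduced words of r and s are ca and cb with d(r,s) = |a| + |b| (`exists_common_prefix`). So the
search runs over pairs of states: first the pairs reached by reading a common word on both sides,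
then those reached by reading further letters, one at a time, on one side. If some r and s have
distance k, then stage k contains an accepting pair (`exists_final`); the words stored at stage k
have distance at most k (`items_spec`). The first stage with an accepting pair therefore gives a
closest pair. Rules and acceptance look only at the states, so one pair of words for each pair of
states is enough, and no new pair of states appears after as many rounds as there are pairs
(`exists_mem_stage_length`). This bounds the rounds, the lengths of the words and the number of
stages to inspect.

For the running time, data are binary trees written in Polish notation on a stack. A program for `f`
replaces the tree of `a` on top of the stack by that of `f a`, whatever lies below. Such functions
are closed under composition, pairing, case distinction and folds whose accumulators stay
polynomially small (`PolyTime.foldl`), and the algorithm is a composition of list functions of this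
kind. -/

/-! ### Structured programs for multi-stack machines -/

namespace StackProgram

open Turing

variable {K : Type} [DecidableEq K] {Γ : K → Type} {Λ Λ' σ : Type}

/-- Relabel the jumps of a statement, and continue with `h` where it halts. -/
def relabel (f : Λ → Λ') (h : TM2.Stmt Γ Λ' σ) : TM2.Stmt Γ Λ σ → TM2.Stmt Γ Λ' σ
  | .push k g q => .push k g (relabel f h q)
  | .peek k g q => .peek k g (relabel f h q)
  | .pop k g q => .pop k g (relabel f h q)
  | .load g q => .load g (relabel f h q)
  | .branch g q₁ q₂ => .branch g (relabel f h q₁) (relabel f h q₂)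
  | .goto g => .goto fun v => f (g v)
  | .halt => h

theorem stepAux_relabel (f : Λ → Λ') (h : TM2.Stmt Γ Λ' σ) (q : TM2.Stmt Γ Λ σ) (v : σ)
    (S : ∀ k, List (Γ k)) :
    TM2.stepAux (relabel f h q) v S =
      match TM2.stepAux q v S with
      | ⟨some l, v', S'⟩ => ⟨some (f l), v', S'⟩
      | ⟨none, v', S'⟩ => TM2.stepAux h v' S' := by
  induction q generalizing v S with
  | branch g q₁ q₂ ih₁ ih₂ =>
    simp only [relabel, TM2.stepAux]
    cases g v <;> simp [ih₁, ih₂]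
  | _ => simp_all [relabel, TM2.stepAux]

/-- The machine `M` gets from one configuration to another one in exactly `n` steps. -/
def Steps (M : Λ → TM2.Stmt Γ Λ σ) : ℕ → TM2.Cfg Γ Λ σ → TM2.Cfg Γ Λ σ → Prop
  | 0, c, c' => c = c'
  | n + 1, c, c' => ∃ d, TM2.step M c = some d ∧ Steps M n d c'

theorem Steps.trans {M : Λ → TM2.Stmt Γ Λ σ} {m n : ℕ} {c d e : TM2.Cfg Γ Λ σ}
    (h₁ : Steps M m c d) (h₂ : Steps M n d e) : Steps M (m + n) c e := by
  induction m generalizing c with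
  | zero => cases h₁; simpa using h₂
  | succ m ih =>
    obtain ⟨c', hc, h⟩ := h₁
    rw [Nat.add_right_comm]
    exact ⟨c', hc, ih h⟩

theorem Steps.one {M : Λ → TM2.Stmt Γ Λ σ} (l : Λ) (v : σ) (S : ∀ k, List (Γ k)) :
    Steps M 1 ⟨some l, v, S⟩ (TM2.stepAux (M l) v S) :=
  ⟨_, rfl, rfl⟩

/-- The form in which Mathlib's `TM2OutputsInTime` counts steps. -/
theorem Steps.iterate {M : Λ → TM2.Stmt Γ Λ σ} {n : ℕ} {c d : TM2.Cfg Γ Λ σ}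
    (h : Steps M n c d) : (flip bind (TM2.step M))^[n] (some c) = some d := by
  induction n generalizing c with
  | zero => cases h; rfl
  | succ n ih =>
    obtain ⟨c', hc, h⟩ := h
    rw [Function.iterate_succ_apply]
    change (flip bind (TM2.step M))^[n] (TM2.step M c) = _
    rw [hc, ih h]

/-- A run of a machine that ends by halting, inside a machine with more labels in which halting is
replaced by the statement `h`. -/
theorem Steps.relabel {M : Λ → TM2.Stmt Γ Λ σ} {M' : Λ' → TM2.Stmt Γ Λ' σ} {f : Λ → Λ'}
    {h : TM2.Stmt Γ Λ' σ} (hM : ∀ l, M' (f l) = relabel f h (M l)) {n : ℕ} {l : Λ} {v v' : σ}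
    {S S' : ∀ k, List (Γ k)} (hs : Steps M n ⟨some l, v, S⟩ ⟨none, v', S'⟩) :
    Steps M' n ⟨some (f l), v, S⟩ (TM2.stepAux h v' S') := by
  induction n generalizing l v S with
  | zero => cases hs
  | succ n ih =>
    obtain ⟨c, hc, hs⟩ := hs
    refine ⟨_, rfl, ?_⟩
    rw [hM, stepAux_relabel]
    simp only [TM2.step, Option.some.injEq] at hc
    rw [hc]
    obtain ⟨_ | l₁, v₁, S₁⟩ := c
    · cases n with
      | zero => cases hs; rfl
      | succ n => obtain ⟨_, h', _⟩ := hs; cases h'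
    · exact ih hs

end StackProgram

/-- A program: finitely many labelled statements, one of which is the entry. -/
structure StackProgram {K : Type} (Γ : K → Type) (σ : Type) where
  /-- the labels -/
  Label : Type
  /-- there are finitely many labels -/
  [fintypeLabel : Fintype Label]
  /-- the statements -/
  code : Label → Turing.TM2.Stmt Γ Label σ
  /-- the label of the first statement -/
  entry : Label

namespace StackProgram

open Turing

variable {K : Type} [DecidableEq K] {Γ : K → Type} {σ : Type}

/-- The program `P`, started with the state `v` and the stacks `S`, halts with `v'` and `S'` after
at most `t` steps. -/
def Exec (P : StackProgram Γ σ) (v : σ) (S : ∀ k, List (Γ k)) (v' : σ) (S' : ∀ k, List (Γ k))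
    (t : ℕ) : Prop :=
  ∃ n ≤ t, Steps P.code n ⟨some P.entry, v, S⟩ ⟨none, v', S'⟩

theorem Exec.mono {P : StackProgram Γ σ} {v v' : σ} {S S' : ∀ k, List (Γ k)} {t t' : ℕ}
    (h : P.Exec v S v' S' t) (ht : t ≤ t') : P.Exec v S v' S' t' := by
  obtain ⟨n, hn, hs⟩ := h
  exact ⟨n, hn.trans ht, hs⟩

/-- The program with a single statement. -/
def single (q : TM2.Stmt Γ Unit σ) : StackProgram Γ σ where
  Label := Unit
  code _ := q
  entry := ()

theorem exec_single {q : TM2.Stmt Γ Unit σ} {v v' : σ} {S S' : ∀ k, List (Γ k)}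
    (h : TM2.stepAux q v S = ⟨none, v', S'⟩) : (single q).Exec v S v' S' 1 :=
  ⟨1, le_rfl, h ▸ Steps.one (M := (single q).code) () v S⟩

/-- Run `P`, then `Q`. -/
def seq (P Q : StackProgram Γ σ) : StackProgram Γ σ where
  Label := P.Label ⊕ Q.Label
  fintypeLabel := letI := P.fintypeLabel; letI := Q.fintypeLabel; inferInstance
  code
    | .inl l => relabel .inl (.goto fun _ => .inr Q.entry) (P.code l)
    | .inr l => relabel .inr .halt (Q.code l)
  entry := .inl P.entry

theorem exec_seq {P Q : StackProgram Γ σ} {v₀ v₁ v₂ : σ} {S₀ S₁ S₂ : ∀ k, List (Γ k)} {t₁ t₂ : ℕ}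
    (h₁ : P.Exec v₀ S₀ v₁ S₁ t₁) (h₂ : Q.Exec v₁ S₁ v₂ S₂ t₂) :
    (P.seq Q).Exec v₀ S₀ v₂ S₂ (t₁ + t₂) := by
  obtain ⟨n₁, hn₁, h₁⟩ := h₁
  obtain ⟨n₂, hn₂, h₂⟩ := h₂
  exact ⟨n₁ + n₂, by omega,
    (h₁.relabel (M' := (P.seq Q).code) (f := .inl) (h := .goto fun _ => .inr Q.entry)
      fun _ => rfl).trans
      (h₂.relabel (M' := (P.seq Q).code) (f := .inr) (h := .halt) fun _ => rfl)⟩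

/-- Execute the statement `q`, then run `P true` or `P false`, according to its jump. -/
def branch (q : TM2.Stmt Γ Bool σ) (P Q : StackProgram Γ σ) : StackProgram Γ σ where
  Label := Unit ⊕ P.Label ⊕ Q.Label
  fintypeLabel := letI := P.fintypeLabel; letI := Q.fintypeLabel; inferInstance
  code
    | .inl _ => relabel (fun b => .inr (cond b (.inl P.entry) (.inr Q.entry))) .halt q
    | .inr (.inl l) => relabel (fun l => .inr (.inl l)) .halt (P.code l)
    | .inr (.inr l) => relabel (fun l => .inr (.inr l)) .halt (Q.code l)
  entry := .inl ()

theorem exec_branch {q : TM2.Stmt Γ Bool σ} {P Q : StackProgram Γ σ} {b : Bool}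
    {v₀ v₁ v₂ : σ} {S₀ S₁ S₂ : ∀ k, List (Γ k)} {t : ℕ}
    (h₁ : TM2.stepAux q v₀ S₀ = ⟨some b, v₁, S₁⟩)
    (h₂ : (cond b P Q).Exec v₁ S₁ v₂ S₂ t) : (branch q P Q).Exec v₀ S₀ v₂ S₂ (1 + t) := by
  obtain ⟨n, hn, h₂⟩ := h₂
  refine ⟨1 + n, by omega, Steps.trans (Steps.one _ _ _) ?_⟩
  simp only [branch, stepAux_relabel, h₁]
  cases b
  · exact h₂.relabel (M' := (branch q P Q).code) (f := fun l => .inr (.inr l)) (h := .halt)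
      fun _ => rfl
  · exact h₂.relabel (M' := (branch q P Q).code) (f := fun l => .inr (.inl l)) (h := .halt)
      fun _ => rfl

/-- Execute the statement `q`; as long as it jumps, run `P` and start again. -/
def loop (q : TM2.Stmt Γ Unit σ) (P : StackProgram Γ σ) : StackProgram Γ σ where
  Label := Unit ⊕ P.Label
  fintypeLabel := letI := P.fintypeLabel; inferInstance
  code
    | .inl _ => relabel (fun _ => .inr P.entry) .halt q
    | .inr l => relabel .inr (.goto fun _ => .inl ()) (P.code l)
  entry := .inl ()

theorem exec_loop_halt {q : TM2.Stmt Γ Unit σ} {P : StackProgram Γ σ} {v v' : σ}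
    {S S' : ∀ k, List (Γ k)} (h : TM2.stepAux q v S = ⟨none, v', S'⟩) :
    (loop q P).Exec v S v' S' 1 := by
  refine ⟨1, le_rfl, ?_⟩
  have := Steps.one (M := (loop q P).code) (.inl ()) v S
  simpa only [loop, stepAux_relabel, h, TM2.stepAux] using this

theorem exec_loop_step {q : TM2.Stmt Γ Unit σ} {P : StackProgram Γ σ} {v₀ v₁ v₂ v₃ : σ}
    {S₀ S₁ S₂ S₃ : ∀ k, List (Γ k)} {t t' : ℕ}
    (h : TM2.stepAux q v₀ S₀ = ⟨some (), v₁, S₁⟩) (h₁ : P.Exec v₁ S₁ v₂ S₂ t)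
    (h₂ : (loop q P).Exec v₂ S₂ v₃ S₃ t') : (loop q P).Exec v₀ S₀ v₃ S₃ (1 + t + t') := by
  obtain ⟨n₁, hn₁, h₁⟩ := h₁
  obtain ⟨n₂, hn₂, h₂⟩ := h₂
  refine ⟨1 + n₁ + n₂, by omega, Steps.trans (Steps.trans (Steps.one _ _ _) ?_) h₂⟩
  simp only [loop, stepAux_relabel, h]
  exact h₁.relabel (M' := (loop q P).code) (f := .inr) (h := .goto fun _ => .inl ()) fun _ => rfl

end StackProgram

/-! ### Trees, and programs for trees on a stack -/

/-- Binary trees whose leaves are blank or carry a letter of `A`. -/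
inductive LeafTree (A : Type) where
  | leaf : Option A → LeafTree A
  | node : LeafTree A → LeafTree A → LeafTree A

/-- The symbols of the Polish notation of a tree: `none` for a node, `some o` for a leaf. -/
abbrev TreeSymbol (A : Type) : Type := Option (Option A)

/-- The Polish notation of a tree. -/
def LeafTree.str {A : Type} : LeafTree A → List (TreeSymbol A)
  | .leaf o => [some o]
  | .node l r => none :: (l.str ++ r.str)

/-- The number of leaves and nodes. -/
def LeafTree.size {A : Type} : LeafTree A → ℕ
  | .leaf _ => 1
  | .node l r => 1 + l.size + r.size

theorem LeafTree.length_str {A : Type} (t : LeafTree A) : t.str.length = t.size := by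
  induction t with
  | leaf o => rfl
  | node l r hl hr => simp [str, size, hl, hr]; omega

theorem LeafTree.size_pos {A : Type} (t : LeafTree A) : 0 < t.size := by
  cases t <;> simp only [size] <;> omega

namespace TreeProgram

open Turing StackProgram

/-- The stacks: one for the input, one for the output, the main one, two auxiliary ones and a
counter. -/
inductive Stack where
  | input
  | output
  | main
  | aux (b : Bool)
  | counter
  deriving DecidableEq, Fintype

/-- The alphabets of the stacks. -/
abbrev Symbol (A : Type) : Stack → Type
  | .input => Bool
  | .output => Option A
  | .main => TreeSymbol A
  | .aux _ => TreeSymbol A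
  | .counter => Unit

variable {A : Type}

/-- The stacks with the given contents. -/
def store (i : List Bool) (o : List (Option A)) (m a b : List (TreeSymbol A)) (c : List Unit) :
    ∀ k, List (Symbol A k)
  | .input => i
  | .output => o
  | .main => m
  | .aux true => a
  | .aux false => b
  | .counter => c

section store

variable (i : List Bool) (o : List (Option A)) (m a b : List (TreeSymbol A)) (c : List Unit)

@[simp] theorem store_input : store i o m a b c .input = i := rfl
@[simp] theorem store_output : store i o m a b c .output = o := rfl
@[simp] theorem store_main : store i o m a b c .main = m := rfl
@[simp] theorem store_aux_true : store i o m a b c (.aux true) = a := rfl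
@[simp] theorem store_aux_false : store i o m a b c (.aux false) = b := rfl
@[simp] theorem store_counter : store i o m a b c .counter = c := rfl

@[simp] theorem update_input (i' : List Bool) :
    Function.update (store i o m a b c) .input i' = store i' o m a b c := by
  funext k; rcases k with _ | _ | _ | _ | _ <;> first | rfl | (rename_i x; cases x <;> rfl)

@[simp] theorem update_output (o' : List (Option A)) :
    Function.update (store i o m a b c) .output o' = store i o' m a b c := by
  funext k; rcases k with _ | _ | _ | _ | _ <;> first | rfl | (rename_i x; cases x <;> rfl)

@[simp] theorem update_main (m' : List (TreeSymbol A)) :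
    Function.update (store i o m a b c) .main m' = store i o m' a b c := by
  funext k; rcases k with _ | _ | _ | _ | _ <;> first | rfl | (rename_i x; cases x <;> rfl)

@[simp] theorem update_aux_true (a' : List (TreeSymbol A)) :
    Function.update (store i o m a b c) (.aux true) a' = store i o m a' b c := by
  funext k; rcases k with _ | _ | _ | _ | _ <;> first | rfl | (rename_i x; cases x <;> rfl)

@[simp] theorem update_aux_false (b' : List (TreeSymbol A)) :
    Function.update (store i o m a b c) (.aux false) b' = store i o m a b' c := by
  funext k; rcases k with _ | _ | _ | _ | _ <;> first | rfl | (rename_i x; cases x <;> rfl)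

@[simp] theorem update_counter (c' : List Unit) :
    Function.update (store i o m a b c) .counter c' = store i o m a b c' := by
  funext k; rcases k with _ | _ | _ | _ | _ <;> first | rfl | (rename_i x; cases x <;> rfl)

end store

/-- The test for the symbol of a node. -/
def isNode : Option (TreeSymbol A) → Bool
  | some none => true
  | _ => false

@[simp] theorem isNode_node : isNode (A := A) (some none) = true := rfl
@[simp] theorem isNode_leaf (o : Option A) : isNode (some (some o)) = false := rfl

/-- Programs for trees; the internal state holds a symbol, or nothing. -/
abbrev Program (A : Type) : Type 1 := StackProgram (Symbol A) (Option (TreeSymbol A))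

variable (A) in
/-- Remove a tree from the main stack, one symbol for each execution of this statement, and push
its symbols on those of the auxiliary stacks that are chosen. The counter holds the number of
trees that are still to be removed. -/
def takeStmt (a b : Bool) : TM2.Stmt (Symbol A) Unit (Option (TreeSymbol A)) :=
  let rest : TM2.Stmt (Symbol A) Unit (Option (TreeSymbol A)) :=
    .branch (isNode) (.push .counter (fun _ => ()) (.load (fun _ => none)
        (.goto fun _ => ())))
      (.pop .counter (fun v _ => v) (.peek .counter (fun _ u => u.map fun _ => none)
        (.branch (fun v => v.isSome) (.load (fun _ => none) (.goto fun _ => ())) .halt)))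
  let rest := cond b (.push (.aux false) (fun v => v.getD none) rest) rest
  let rest := cond a (.push (.aux true) (fun v => v.getD none) rest) rest
  .pop .main (fun _ s => s) rest

/-- A node turns one pending tree into two and a leaf completes one, so the counter reaches zero
exactly at the end of the Polish notation. The remaining counter `c` is arbitrary because the left
subtree is read while the right one is pending. -/
theorem steps_take (a b : Bool) (t : LeafTree A) (i : List Bool) (o : List (Option A))
    (m x y : List (TreeSymbol A)) (c : List Unit) :
    Steps (single (takeStmt A a b)).code t.size
      ⟨some (), none, store i o (t.str ++ m) x y (() :: c)⟩
      ⟨if c = [] then none else some (), none,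
        store i o m (cond a (t.str.reverse ++ x) x) (cond b (t.str.reverse ++ y) y) c⟩ := by
  induction t generalizing m x y c with
  | leaf s =>
    refine ⟨_, rfl, ?_⟩
    cases a <;> cases b <;> cases c <;> simp [single, takeStmt, LeafTree.str, Steps]
  | node l r hl hr =>
    have h₁ : Steps (single (takeStmt A a b)).code 1
        ⟨some (), none, store i o ((LeafTree.node l r).str ++ m) x y (() :: c)⟩
        ⟨some (), none, store i o (l.str ++ (r.str ++ m)) (cond a (none :: x) x)
          (cond b (none :: y) y) (() :: () :: c)⟩ := by
      refine ⟨_, rfl, ?_⟩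
      cases a <;> cases b <;> simp [single, takeStmt, LeafTree.str, Steps]
    have h₂ := (h₁.trans (hl _ _ _ _)).trans (hr m _ _ c)
    cases a <;> cases b <;> simpa [LeafTree.size, LeafTree.str] using h₂

variable (A) in
/-- Remove a tree from the main stack, and push its symbols on those of the auxiliary stacks that
are chosen. -/
def take (a b : Bool) : Program A :=
  seq (single (.push .counter (fun _ => ()) .halt)) (single (takeStmt A a b))

theorem exec_take (a b : Bool) (t : LeafTree A) (i : List Bool) (o : List (Option A))
    (m x y : List (TreeSymbol A)) :
    (take A a b).Exec none (store i o (t.str ++ m) x y []) none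
      (store i o m (cond a (t.str.reverse ++ x) x) (cond b (t.str.reverse ++ y) y) [])
      (1 + t.size) := by
  refine exec_seq (v₁ := none) (S₁ := store i o (t.str ++ m) x y [()]) (exec_single (by simp))
    ⟨_, le_rfl, ?_⟩
  have h := steps_take a b t i o m x y []
  rw [if_pos rfl] at h
  exact h

variable (A) in
/-- Move the contents of an auxiliary stack to the main stack. -/
def flush (b : Bool) : Program A :=
  single (.pop (.aux b) (fun _ s => s) (.branch (fun v => v.isSome)
    (.push .main (fun v => v.getD none) (.load (fun _ => none) (.goto fun _ => ()))) .halt))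

theorem exec_flush_true (i : List Bool) (o : List (Option A)) (m x y : List (TreeSymbol A))
    (c : List Unit) :
    (flush A true).Exec none (store i o m x y c) none (store i o (x.reverse ++ m) [] y c)
      (x.length + 1) := by
  refine ⟨_, le_rfl, ?_⟩
  induction x generalizing m with
  | nil => exact ⟨_, rfl, by simp [flush, single, Steps]⟩
  | cons s x ih =>
    refine ⟨_, rfl, ?_⟩
    simpa [flush, single] using ih (s :: m)

theorem exec_flush_false (i : List Bool) (o : List (Option A)) (m x y : List (TreeSymbol A))
    (c : List Unit) :
    (flush A false).Exec none (store i o m x y c) none (store i o (y.reverse ++ m) x [] c)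
      (y.length + 1) := by
  refine ⟨_, le_rfl, ?_⟩
  induction y generalizing m with
  | nil => exact ⟨_, rfl, by simp [flush, single, Steps]⟩
  | cons s x ih =>
    refine ⟨_, rfl, ?_⟩
    simpa [flush, single] using ih (s :: m)

/-- The program `P` turns the contents `x` of the main stack into `y` within `t` steps, if all other
stacks are empty. -/
def Runs (P : Program A) (x y : List (TreeSymbol A)) (t : ℕ) : Prop :=
  P.Exec none (store [] [] x [] [] []) none (store [] [] y [] [] []) t

theorem Runs.mono {P : Program A} {x y : List (TreeSymbol A)} {t t' : ℕ} (h : Runs P x y t)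
    (ht : t ≤ t') : Runs P x y t' :=
  Exec.mono h ht

theorem Runs.seq {P Q : Program A} {x y z : List (TreeSymbol A)} {t t' : ℕ} (h : Runs P x y t)
    (h' : Runs Q y z t') : Runs (P.seq Q) x z (t + t') :=
  exec_seq h h'

variable (A) in
/-- Do nothing. -/
def skip : Program A := single .halt

theorem runs_skip (x : List (TreeSymbol A)) : Runs (skip A) x x 1 :=
  exec_single (by simp)

/-- Push a symbol on the main stack. -/
def pushSymbol (s : TreeSymbol A) : Program A := single (.push .main (fun _ => s) .halt)

theorem runs_pushSymbol (s : TreeSymbol A) (x : List (TreeSymbol A)) :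
    Runs (pushSymbol s) x (s :: x) 1 :=
  exec_single (by simp)

variable (A) in
/-- Remove a symbol from the main stack. -/
def popSymbol : Program A := single (.pop .main (fun v _ => v) .halt)

theorem runs_popSymbol (s : TreeSymbol A) (x : List (TreeSymbol A)) :
    Runs (popSymbol A) (s :: x) x 1 :=
  exec_single (by simp)

variable (A) in
/-- Remove a tree from the main stack. -/
def drop : Program A := take A false false

theorem runs_drop (t : LeafTree A) (x : List (TreeSymbol A)) :
    Runs (drop A) (t.str ++ x) x (1 + t.size) := by
  simpa [Runs, drop] using exec_take false false t [] [] x [] []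

variable (A) in
/-- Duplicate the topmost tree on the main stack. -/
def dup : Program A := ((take A true true).seq (flush A true)).seq (flush A false)

/-- `take` leaves the string reversed on both auxiliary stacks, and each `flush` reverses it back.
-/
theorem runs_dup (t : LeafTree A) (x : List (TreeSymbol A)) :
    Runs (dup A) (t.str ++ x) (t.str ++ (t.str ++ x)) (3 + 3 * t.size) := by
  have h := exec_seq (exec_seq (exec_take true true t [] [] x [] [])
    (exec_flush_true ..)) (exec_flush_false ..)
  refine Runs.mono (t := _) (by simpa [Runs, dup] using h) ?_
  simp [LeafTree.length_str]; omega

variable (A) in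
/-- Swap the two topmost trees on the main stack. -/
def swap : Program A :=
  (((take A true false).seq (take A false true)).seq (flush A true)).seq (flush A false)

theorem runs_swap (t u : LeafTree A) (x : List (TreeSymbol A)) :
    Runs (swap A) (t.str ++ (u.str ++ x)) (u.str ++ (t.str ++ x)) (4 + 2 * t.size + 2 * u.size) := by
  have h := exec_seq (exec_seq (exec_seq (exec_take true false t [] [] (u.str ++ x) [] [])
    (exec_take false true u ..)) (exec_flush_true ..)) (exec_flush_false ..)
  refine Runs.mono (t := _) (by simpa [Runs, swap] using h) ?_
  simp [LeafTree.length_str]; omega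

/-- Branch according to the topmost symbol of the main stack. -/
def ifTop (p : TreeSymbol A → Bool) (P Q : Program A) : Program A :=
  branch (.peek .main (fun _ s => s) (.branch (fun v => p (v.getD none))
    (.load (fun _ => none) (.goto fun _ => true))
    (.load (fun _ => none) (.goto fun _ => false)))) P Q

theorem runs_ifTop {p : TreeSymbol A → Bool} {P Q : Program A} {s : TreeSymbol A}
    {x y : List (TreeSymbol A)} {t : ℕ} (h : Runs (cond (p s) P Q) (s :: x) y t) :
    Runs (ifTop p P Q) (s :: x) y (1 + t) := by
  refine exec_branch (b := p s) (S₁ := store [] [] (s :: x) [] [] []) (v₁ := none) ?_ h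
  cases hp : p s <;> simp [hp]

/-- As long as the topmost symbol of the main stack is a node followed by a node, run `P`. -/
def whileNode (P : Program A) : Program A :=
  loop (.pop .main (fun v _ => v) (.peek .main (fun _ s => s)
    (.push .main (fun _ => none) (.branch (isNode)
      (.load (fun _ => none) (.goto fun _ => ())) (.load (fun _ => none) .halt))))) P

/-- The string of a pair starts with the symbol of the pair itself; if the first component is a
list, the second symbol tells whether that list is empty. Thus `whileNode` loops until a list is
used up. -/
theorem runs_whileNode_halt {P : Program A} (o : Option A) (x : List (TreeSymbol A)) :
    Runs (whileNode P) (none :: some o :: x) (none :: some o :: x) 1 :=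
  exec_loop_halt (by simp)

theorem runs_whileNode_step {P : Program A} {x y z : List (TreeSymbol A)} {t t' : ℕ}
    (h : Runs P (none :: none :: x) y t) (h' : Runs (whileNode P) y z t') :
    Runs (whileNode P) (none :: none :: x) z (1 + t + t') :=
  exec_loop_step (v₁ := none) (S₁ := store [] [] (none :: none :: x) [] [] []) (by simp) h h'

/-- A list of bits as a tree. -/
def bitsTree : List Bool → LeafTree A
  | [] => .leaf none
  | b :: l => .node (cond b (.node (.leaf none) (.leaf none)) (.leaf none)) (bitsTree l)

/-- A list of leaves as a tree. -/
def leavesTree : List (Option A) → LeafTree A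
  | [] => .leaf none
  | o :: l => .node (.leaf o) (leavesTree l)

variable (A) in
/-- Move the input to an auxiliary stack. -/
def fetch : Program A :=
  single (.pop .input (fun _ s => s.map fun b => cond b none (some none))
    (.branch (fun v => v.isSome) (.push (.aux true) (fun v => v.getD none)
      (.load (fun _ => none) (.goto fun _ => ()))) .halt))

theorem exec_fetch (i : List Bool) (x : List (TreeSymbol A)) :
    (fetch A).Exec none (store i [] [] x [] []) none
      (store [] [] [] ((i.map fun b => cond b none (some none)).reverse ++ x) [] [])
      (i.length + 1) := by
  refine ⟨_, le_rfl, ?_⟩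
  induction i generalizing x with
  | nil => exact ⟨_, rfl, by simp [fetch, single, Steps]⟩
  | cons b i ih =>
    refine ⟨_, rfl, ?_⟩
    simpa [fetch, single] using ih (cond b none (some none) :: x)

variable (A) in
/-- Turn symbols on an auxiliary stack into a tree for a list of bits. -/
def assemble : Program A :=
  single (.pop (.aux true) (fun _ s => s) (.branch (fun v => v.isSome)
    (.push .main (fun _ => some none) (.branch isNode
      (.push .main (fun _ => some none) (.push .main (fun _ => none) (.push .main (fun _ => none)
        (.load (fun _ => none) (.goto fun _ => ())))))
      (.push .main (fun _ => none) (.load (fun _ => none) (.goto fun _ => ()))))) .halt))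

/-- The string of a list grows at its front, so the last bit must come first; this is the order in
which `fetch` leaves the bits. -/
theorem exec_assemble (l i : List Bool) :
    (assemble A).Exec none
      (store [] [] (bitsTree i).str (l.map fun b => cond b none (some none)) [] []) none
      (store [] [] (bitsTree (l.reverse ++ i)).str [] [] []) (l.length + 1) := by
  refine ⟨_, le_rfl, ?_⟩
  induction l generalizing i with
  | nil => exact ⟨_, rfl, by simp [assemble, single, Steps]⟩
  | cons b l ih =>
    refine ⟨_, rfl, ?_⟩
    have := ih (b :: i)
    cases b <;> simpa [assemble, single, bitsTree, LeafTree.str] using this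

variable (A) in
/-- Turn the input into a tree. -/
def readInput : Program A := ((fetch A).seq (pushSymbol (some none))).seq (assemble A)

theorem exec_readInput (i : List Bool) :
    (readInput A).Exec none (store i [] [] [] [] []) none
      (store [] [] (bitsTree i).str [] [] []) (2 * i.length + 3) := by
  have h := exec_seq (exec_seq (exec_fetch (A := A) i []) (exec_single (v' := none)
    (S' := store [] [] [some none] ((i.map fun b => cond b none (some none)).reverse ++ []) [] [])
    (q := .push .main (fun _ => some none) .halt) (by simp)))
    (Q := assemble A) (t₂ := i.length + 1) (v₂ := none)
    (S₂ := store [] [] (bitsTree i).str [] [] [])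
    (by simpa [bitsTree, LeafTree.str] using exec_assemble (A := A) i.reverse [])
  exact h.mono (by omega)

variable (A) in
/-- Move the leaves of a tree for a list of leaves to an auxiliary stack. -/
def disassemble : Program A :=
  single (.pop .main (fun _ s => s) (.branch isNode
    (.pop .main (fun _ s => s) (.push (.aux true) (fun v => v.getD none)
      (.load (fun _ => none) (.goto fun _ => ())))) (.load (fun _ => none) .halt)))

theorem exec_disassemble (l : List (Option A)) (x : List (TreeSymbol A)) :
    (disassemble A).Exec none (store [] [] (leavesTree l).str x [] []) none
      (store [] [] [] ((l.map some).reverse ++ x) [] []) (l.length + 1) := by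
  refine ⟨_, le_rfl, ?_⟩
  induction l generalizing x with
  | nil => exact ⟨_, rfl, by simp [disassemble, single, Steps, leavesTree, LeafTree.str]⟩
  | cons o l ih =>
    refine ⟨_, rfl, ?_⟩
    simpa [disassemble, single, leavesTree, LeafTree.str] using ih (some o :: x)

variable (A) in
/-- Move leaves from an auxiliary stack to the output. -/
def emit : Program A :=
  single (.pop (.aux true) (fun _ s => s) (.branch (fun v => v.isSome)
    (.push .output (fun v => (v.getD none).getD none)
      (.load (fun _ => none) (.goto fun _ => ()))) .halt))

theorem exec_emit (l o : List (Option A)) :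
    (emit A).Exec none (store [] o [] (l.map some) [] []) none
      (store [] (l.reverse ++ o) [] [] [] []) (l.length + 1) := by
  refine ⟨_, le_rfl, ?_⟩
  induction l generalizing o with
  | nil => exact ⟨_, rfl, by simp [emit, single, Steps]⟩
  | cons s l ih =>
    refine ⟨_, rfl, ?_⟩
    simpa [emit, single] using ih (s :: o)

variable (A) in
/-- Turn a tree for a list of leaves into the output. -/
def writeOutput : Program A := (disassemble A).seq (emit A)

theorem exec_writeOutput (l : List (Option A)) :
    (writeOutput A).Exec none (store [] [] (leavesTree l).str [] [] []) none
      (store [] l [] [] [] []) (2 * l.length + 2) := by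
  have h := exec_seq (exec_disassemble l []) (Q := emit A) (t₂ := l.length + 1) (v₂ := none)
    (S₂ := store [] l [] [] [] []) (by simpa using exec_emit l.reverse [])
  exact h.mono (by omega)

end TreeProgram

/-! ### Programs for trees as Turing machines -/

namespace StackProgram

open Turing TreeProgram

/-- A program for trees as a machine. -/
def toFinTM2 {A : Type} [Fintype A] (P : Program A) : FinTM2 where
  K := Stack
  k₀ := .input
  k₁ := .output
  Γ := Symbol A
  Λ := P.Label
  main := P.entry
  ΛFin := P.fintypeLabel
  σ := Option (TreeSymbol A)
  initialState := none
  Γk₀Fin := inferInstanceAs (Fintype Bool)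
  m := P.code

/-- `haltList` demands the initial internal state and empty stacks except for the output, which is
why all programs clean up after themselves. -/
theorem nonempty_tm2OutputsInTime {A : Type} [Fintype A] {P : Program A} {i : List Bool}
    {o : List (Option A)} {t : ℕ}
    (h : P.Exec none (store i [] [] [] [] []) none (store [] o [] [] [] []) t) :
    Nonempty (TM2OutputsInTime P.toFinTM2 i (some o) t) := by
  obtain ⟨n, hn, h⟩ := h
  refine ⟨⟨⟨n, ?_⟩, hn⟩⟩
  have hi : initList P.toFinTM2 i = ⟨some P.entry, none, store i [] [] [] [] []⟩ := by
    simp only [initList]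
    congr 1
    funext k; rcases k with _ | _ | _ | _ | _ <;> first | rfl | (rename_i x; cases x <;> rfl)
  have ho : haltList P.toFinTM2 o = ⟨none, none, store [] o [] [] [] []⟩ := by
    simp only [haltList]
    congr 1
    funext k; rcases k with _ | _ | _ | _ | _ <;> first | rfl | (rename_i x; cases x <;> rfl)
  have ho' : Option.map (haltList P.toFinTM2) (some o) = some _ := congrArg some ho
  rw [hi, ho']
  exact h.iterate

end StackProgram

/-! ### Polynomial time functions between types coded by trees -/

/-- A representation of the elements of `α` by trees with leaves in `A`. -/
class TreeCode (A : Type) (α : Type) where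
  /-- the tree of an element -/
  code : α → LeafTree A

namespace TreeCode

variable {A : Type} {α β : Type}

instance : TreeCode A A := ⟨fun x => .leaf (some x)⟩

instance : TreeCode A Unit := ⟨fun _ => .leaf none⟩

/-- These are the trees of `[()]` and `[]`, so that testing a truth value is a case distinction on a
list. -/
instance : TreeCode A Bool := ⟨fun b => cond b (.node (.leaf none) (.leaf none)) (.leaf none)⟩

instance [TreeCode A α] [TreeCode A β] : TreeCode A (α × β) := ⟨fun p => .node (code p.1) (code p.2)⟩

/-- The tree of a list. -/
def listCode [TreeCode A α] : List α → LeafTree A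
  | [] => .leaf none
  | a :: l => .node (code a) (listCode l)

instance [TreeCode A α] : TreeCode A (List α) := ⟨listCode⟩

instance [TreeCode A α] : TreeCode A (Option α) := ⟨fun o => code o.toList⟩

/-- Unary coding makes recursion on numbers a special case of recursion along lists. -/
instance : TreeCode A ℕ := ⟨fun n => code (List.replicate n ())⟩

/-- The number of leaves and nodes of the tree of an element. -/
def size (A : Type) {α : Type} [TreeCode A α] (a : α) : ℕ := (code a : LeafTree A).size

section size

variable [TreeCode A α] [TreeCode A β]

theorem size_pos (a : α) : 0 < size A a := LeafTree.size_pos _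

@[simp] theorem size_unit (a : Unit) : size A a = 1 := rfl

@[simp] theorem size_atom (a : A) : size A a = 1 := rfl

theorem size_bool_le (b : Bool) : size A b ≤ 3 := by
  cases b <;> simp [size, code, LeafTree.size]

@[simp] theorem size_pair (a : α) (b : β) : size A (a, b) = 1 + size A a + size A b := rfl

@[simp] theorem size_nil : size A ([] : List α) = 1 := rfl

@[simp] theorem size_cons (a : α) (l : List α) : size A (a :: l) = 1 + size A a + size A l := rfl

theorem size_list (l : List α) : size A l = 1 + (l.map fun a => 1 + size A a).sum := by
  induction l with
  | nil => rfl
  | cons a l ih => simp [ih]; omega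

theorem size_append (l l' : List α) : size A (l ++ l') + 1 = size A l + size A l' := by
  simp [size_list]; omega

theorem size_nat (n : ℕ) : size A n = 1 + 2 * n := by
  change size A (List.replicate n ()) = _
  simp [size_list]; omega

theorem length_le_size (l : List α) : l.length ≤ size A l := by
  induction l with
  | nil => simp
  | cons a l ih => simp; omega

theorem size_le_of_forall {l : List α} {n : ℕ} (h : ∀ a ∈ l, size A a ≤ n) :
    size A l ≤ 1 + l.length * (1 + n) := by
  induction l with
  | nil => simp
  | cons a l ih =>
    have h₁ := ih fun b hb => h b (List.mem_cons_of_mem _ hb)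
    have h₂ := h a List.mem_cons_self
    simp only [size_cons, List.length_cons, add_mul]
    omega

theorem size_le_of_mem {l : List α} {a : α} (h : a ∈ l) : size A a ≤ size A l := by
  induction l with
  | nil => simp at h
  | cons b l ih =>
    rcases List.mem_cons.1 h with rfl | h
    · simp; omega
    · have := ih h; simp; omega

theorem size_sublist {l l' : List α} (h : l.Sublist l') : size A l ≤ size A l' := by
  induction h with
  | slnil => rfl
  | cons a _ ih => simp; omega
  | cons_cons a _ ih => simp; omega

end size

end TreeCode

open TreeCode

/-- A function to the natural numbers that is bounded by a polynomial in the size of the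
argument. -/
def PolyBounded (A : Type) {α : Type} [TreeCode A α] (t : α → ℕ) : Prop :=
  ∃ p : Polynomial ℕ, ∀ a, t a ≤ p.eval (size A a)

theorem Polynomial.eval_nat_mono (p : Polynomial ℕ) : Monotone fun n => p.eval n := by
  intro m n h
  simp only [Polynomial.eval_eq_sum]
  exact Finset.sum_le_sum fun i _ => Nat.mul_le_mul_left _ (Nat.pow_le_pow_left h _)

namespace PolyBounded

variable {A : Type} {α : Type} [TreeCode A α] {t t' : α → ℕ}

theorem mono (h : PolyBounded A t') (ht : ∀ a, t a ≤ t' a) : PolyBounded A t := by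
  obtain ⟨p, hp⟩ := h
  exact ⟨p, fun a => (ht a).trans (hp a)⟩

theorem size : PolyBounded A fun a : α => size A a :=
  ⟨.X, fun a => by simp⟩

theorem const (n : ℕ) : PolyBounded A fun _ : α => n :=
  ⟨.C n, fun a => by simp⟩

theorem add (h : PolyBounded A t) (h' : PolyBounded A t') : PolyBounded A fun a => t a + t' a := by
  obtain ⟨p, hp⟩ := h
  obtain ⟨q, hq⟩ := h'
  exact ⟨p + q, fun a => by simpa using Nat.add_le_add (hp a) (hq a)⟩

theorem mul (h : PolyBounded A t) (h' : PolyBounded A t') : PolyBounded A fun a => t a * t' a := by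
  obtain ⟨p, hp⟩ := h
  obtain ⟨q, hq⟩ := h'
  exact ⟨p * q, fun a => by simpa using Nat.mul_le_mul (hp a) (hq a)⟩

theorem eval (p : Polynomial ℕ) (h : PolyBounded A t) : PolyBounded A fun a => p.eval (t a) := by
  obtain ⟨q, hq⟩ := h
  exact ⟨p.comp q, fun a => by simpa using p.eval_nat_mono (hq a)⟩

theorem comp {β : Type} [TreeCode A β] {t : β → ℕ} (h : PolyBounded A t) {f : α → β}
    (hf : PolyBounded A fun a => TreeCode.size A (f a)) : PolyBounded A fun a => t (f a) := by
  obtain ⟨p, hp⟩ := h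
  exact (hf.eval p).mono fun a => hp _

end PolyBounded

/-- A function that is computed in polynomial time by a program for trees. -/
@[fun_prop]
def PolyTime (A : Type) {α β : Type} [TreeCode A α] [TreeCode A β] (f : α → β) : Prop :=
  ∃ (P : TreeProgram.Program A) (t : α → ℕ), PolyBounded A t ∧
    (PolyBounded A fun a => size A (f a)) ∧
    ∀ a s, TreeProgram.Runs P ((code a : LeafTree A).str ++ s) ((code (f a) : LeafTree A).str ++ s)
      (t a)

namespace PolyTime

open TreeProgram

variable {A : Type} {α β γ δ : Type} [TreeCode A α] [TreeCode A β] [TreeCode A γ] [TreeCode A δ]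

theorem size {f : α → β} (hf : PolyTime A f) : PolyBounded A fun a => size A (f a) := by
  obtain ⟨P, t, ht, hs, h⟩ := hf
  exact hs

/-- A function that leaves the tree unchanged. -/
theorem of_code_eq {f : α → β} (h : ∀ a, (code (f a) : LeafTree A) = code a) : PolyTime A f :=
  ⟨skip A, fun _ => 1, .const 1, PolyBounded.size.mono fun a => by simp [TreeCode.size, h],
    fun a s => by rw [h]; exact runs_skip _⟩

@[fun_prop]
protected theorem id : PolyTime A fun a : α => a := of_code_eq fun _ => rfl

@[fun_prop]
theorem comp {g : β → γ} {f : α → β} (hg : PolyTime A g) (hf : PolyTime A f) :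
    PolyTime A fun a => g (f a) := by
  obtain ⟨P, t, ht, hs, h⟩ := hf
  obtain ⟨Q, u, hu, hr, k⟩ := hg
  exact ⟨P.seq Q, fun a => t a + u (f a), ht.add (hu.comp hs), hr.comp hs,
    fun a s => (h a s).seq (k _ s)⟩

/-- A program that pushes some symbols. -/
def pushSymbols : List (TreeSymbol A) → Program A
  | [] => skip A
  | s :: l => (pushSymbols l).seq (pushSymbol s)

theorem runs_pushSymbols (l x : List (TreeSymbol A)) :
    Runs (pushSymbols l) x (l ++ x) (l.length + 1) := by
  induction l with
  | nil => exact runs_skip x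
  | cons s l ih => exact ih.seq (runs_pushSymbol s _)

@[fun_prop]
theorem const (b : β) : PolyTime A fun _ : α => b :=
  ⟨(drop A).seq (pushSymbols (code b : LeafTree A).str), fun a => 1 + TreeCode.size A a +
    ((code b : LeafTree A).str.length + 1), ((PolyBounded.const 1).add .size).add (.const _),
    .const _, fun _ s => (runs_drop _ s).seq (runs_pushSymbols _ s)⟩

@[fun_prop]
-- The top of the stack runs through a; a, a; f a, a; a, f a; g a, f a; f a, g a; then the symbol of
-- a pair is put in front. The programs for `f` and `g` leave what lies below untouched.
theorem pair {f : α → β} {g : α → γ} (hf : PolyTime A f) (hg : PolyTime A g) :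
    PolyTime A fun a => (f a, g a) := by
  obtain ⟨P, t, ht, hs, h⟩ := hf
  obtain ⟨Q, u, hu, hr, k⟩ := hg
  refine ⟨(((((dup A).seq P).seq (swap A)).seq Q).seq (swap A)).seq (pushSymbol none),
    fun a => 3 + 3 * TreeCode.size A a + t a +
      (4 + 2 * TreeCode.size A (f a) + 2 * TreeCode.size A a) + u a +
      (4 + 2 * TreeCode.size A (g a) + 2 * TreeCode.size A (f a)) + 1, ?_, ?_, fun a s => ?_⟩
  · exact (((((((PolyBounded.const 3).add ((PolyBounded.const 3).mul .size)).add ht).add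
      (((PolyBounded.const 4).add ((PolyBounded.const 2).mul hs)).add
        ((PolyBounded.const 2).mul .size)))).add hu).add
      (((PolyBounded.const 4).add ((PolyBounded.const 2).mul hr)).add
        ((PolyBounded.const 2).mul hs))).add (.const 1)
  · exact (((PolyBounded.const 1).add hs).add hr).mono fun _ => le_rfl
  · have := ((((((runs_dup (code a) s).seq (h a _)).seq (runs_swap (code (f a)) (code a) s)).seq
      (k a _)).seq (runs_swap (code (g a)) (code (f a)) s)).seq (runs_pushSymbol none _))
    simpa [code, LeafTree.str, TreeCode.size] using this

protected theorem fst : PolyTime A fun p : α × β => p.1 := by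
  refine ⟨((popSymbol A).seq (swap A)).seq (drop A), fun p => 1 +
    (4 + 2 * TreeCode.size A p + 2 * TreeCode.size A p) + (1 + TreeCode.size A p), ?_,
    PolyBounded.size.mono fun p => ?_, fun p s => ?_⟩
  · exact ((PolyBounded.const 1).add (((PolyBounded.const 4).add ((PolyBounded.const 2).mul
      .size)).add ((PolyBounded.const 2).mul .size))).add ((PolyBounded.const 1).add .size)
  · obtain ⟨a, b⟩ := p
    simp; omega
  · obtain ⟨a, b⟩ := p
    have := ((runs_popSymbol none ((code a : LeafTree A).str ++ ((code b).str ++ s))).seq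
      (runs_swap (code a) (code b) s)).seq (runs_drop (code b) _)
    refine Runs.mono (t := _) (by simpa [code, LeafTree.str] using this) ?_
    simp [TreeCode.size, code, LeafTree.size]; omega

protected theorem snd : PolyTime A fun p : α × β => p.2 := by
  refine ⟨(popSymbol A).seq (drop A), fun p => 1 + (1 + TreeCode.size A p), ?_,
    PolyBounded.size.mono fun p => ?_, fun p s => ?_⟩
  · exact (PolyBounded.const 1).add ((PolyBounded.const 1).add .size)
  · obtain ⟨a, b⟩ := p
    simp
  · obtain ⟨a, b⟩ := p
    have := (runs_popSymbol none ((code a : LeafTree A).str ++ ((code b).str ++ s))).seq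
      (runs_drop (code a) _)
    refine Runs.mono (t := _) (by simpa [code, LeafTree.str] using this) ?_
    simp [TreeCode.size, code, LeafTree.size]; omega

@[fun_prop]
theorem fst' {f : α → β × γ} (hf : PolyTime A f) : PolyTime A fun a => (f a).1 :=
  PolyTime.fst.comp hf

@[fun_prop]
theorem snd' {f : α → β × γ} (hf : PolyTime A f) : PolyTime A fun a => (f a).2 :=
  PolyTime.snd.comp hf

/-- A case distinction on a list. -/
theorem listCases {f : α → β} {g : α × γ × List γ → β} (hf : PolyTime A f) (hg : PolyTime A g) :
    PolyTime A fun p : List γ × α =>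
      match p.1 with
      | [] => f p.2
      | c :: l => g (p.2, c, l) := by
  obtain ⟨P, t, ht, hs, h⟩ := hf
  obtain ⟨Q, u, hu, hr, k⟩ := hg
  have hbound : ∀ (t : α → ℕ) (u : α × γ × List γ → ℕ), PolyBounded A t → PolyBounded A u →
      PolyBounded A fun p : List γ × α =>
        match p.1 with
        | [] => t p.2
        | c :: l => u (p.2, c, l) := by
    rintro t u ⟨p, hp⟩ ⟨q, hq⟩
    refine ⟨p + q, ?_⟩
    rintro ⟨_ | ⟨c, l⟩, a⟩
    · refine (hp a).trans ?_
      have := p.eval_nat_mono (show TreeCode.size A a ≤ TreeCode.size A (([] : List γ), a) by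
        simp)
      simp only [Polynomial.eval_add] at this ⊢; omega
    · refine (hq _).trans ?_
      have := q.eval_nat_mono (show TreeCode.size A (a, c, l) ≤ TreeCode.size A (c :: l, a) by
        simp; omega)
      simp only [Polynomial.eval_add] at this ⊢; omega
  -- Without the symbol of the pair, the top symbol decides whether the list is empty. A nonempty
  -- list has the same tree as the pair of its head and tail, so a swap and a new pair symbol
  -- produce the argument of `g`.
  refine ⟨(popSymbol A).seq (ifTop Option.isNone (((swap A).seq (pushSymbol none)).seq Q)
    ((popSymbol A).seq P)), fun p => 1 + (1 + ((4 + 2 * TreeCode.size A p + 2 * TreeCode.size A p) +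
    1 + match p.1 with
        | [] => t p.2
        | c :: l => u (p.2, c, l))), ?_, (hbound _ _ hs hr).mono ?_, ?_⟩
  · exact (PolyBounded.const 1).add ((PolyBounded.const 1).add (((((PolyBounded.const 4).add
      ((PolyBounded.const 2).mul .size)).add ((PolyBounded.const 2).mul .size)).add
      (.const 1)).add (hbound t u ht hu)))
  · rintro ⟨_ | ⟨c, l⟩, a⟩ <;> rfl
  · rintro ⟨_ | ⟨c, l⟩, a⟩ s
    · refine Runs.mono (t := 1 + (1 + (1 + t a))) ?_ (by dsimp only; omega)
      refine (runs_popSymbol none _).seq (runs_ifTop (s := some none) ?_)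
      exact (runs_popSymbol _ _).seq (by simpa using h a s)
    · have hk : Runs Q (none :: ((code a : LeafTree A).str ++ ((code (c :: l)).str ++ s)))
          ((code (g (a, c, l)) : LeafTree A).str ++ s) (u (a, c, l)) := by
        simpa [code, listCode, LeafTree.str] using k (a, c, l) s
      have h₁ : Runs (((swap A).seq (pushSymbol none)).seq Q) _ _ _ :=
        ((runs_swap (code (c :: l)) (code a) s).seq (runs_pushSymbol none _)).seq hk
      have h₂ := (runs_popSymbol none _).seq (runs_ifTop (p := Option.isNone) (s := none)
        (P := ((swap A).seq (pushSymbol none)).seq Q) (Q := (popSymbol A).seq P) h₁)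
      refine Runs.mono (t := _) (by simpa [code, listCode, LeafTree.str] using h₂) ?_
      simp [TreeCode.size, code, listCode, LeafTree.size]; omega

theorem match_list {l : α → List γ} {f : α → β} {g : α × γ × List γ → β} (hl : PolyTime A l)
    (hf : PolyTime A f) (hg : PolyTime A g) :
    PolyTime A fun a =>
      match l a with
      | [] => f a
      | c :: l => g (a, c, l) :=
  (listCases hf hg).comp (hl.pair .id)

/-- A case distinction on a letter. -/
theorem of_forall_atom [Fintype A] {f : A → α → β} (hf : ∀ x, PolyTime A (f x)) :
    PolyTime A fun p : A × α => f p.1 p.2 := by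
  classical
  -- The program compares the top symbol with one letter after the other; nothing is claimed for
  -- letters outside `l`, so the empty list can be served by `skip`.
  have key : ∀ l : List A, ∃ (P : Program A) (t r : α → ℕ), PolyBounded A t ∧ PolyBounded A r ∧
      ∀ x ∈ l, ∀ a, TreeCode.size A (f x a) ≤ r a ∧ ∀ s,
        Runs P (some (some x) :: ((code a : LeafTree A).str ++ s))
          ((code (f x a) : LeafTree A).str ++ s) (t a) := by
    intro l
    induction l with
    | nil => exact ⟨skip A, _, _, .const 0, .const 0, by simp⟩
    | cons y l ih =>
      obtain ⟨P, t, r, ht, hr, h⟩ := ih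
      obtain ⟨Q, u, hu, hq, k⟩ := hf y
      refine ⟨ifTop (fun s => decide (s = some (some y))) ((popSymbol A).seq Q) P,
        fun a => 1 + (1 + u a + t a), fun a => r a + TreeCode.size A (f y a),
        (PolyBounded.const 1).add (((PolyBounded.const 1).add hu).add ht), hr.add hq, ?_⟩
      intro x hx a
      by_cases hxy : x = y
      · subst hxy
        refine ⟨Nat.le_add_left _ _, fun s => runs_ifTop ?_⟩
        simp only [decide_true, cond_true]
        exact ((runs_popSymbol _ _).seq (k a s)).mono (by omega)
      · have hx' := h x ((List.mem_cons.1 hx).resolve_left hxy) a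
        refine ⟨hx'.1.trans (Nat.le_add_right _ _), fun s => runs_ifTop ?_⟩
        simp only [Option.some.injEq, hxy, decide_false, cond_false]
        exact (hx'.2 s).mono (by omega)
  obtain ⟨P, t, r, ht, hr, h⟩ := key Finset.univ.toList
  have hsnd : PolyBounded A fun p : A × α => TreeCode.size A p.2 :=
    PolyBounded.size.mono fun p => by obtain ⟨x, a⟩ := p; simp
  refine ⟨(popSymbol A).seq P, fun p => 1 + t p.2, (PolyBounded.const 1).add (ht.comp hsnd),
    (hr.comp hsnd).mono fun p => (h p.1 (by simp) p.2).1, ?_⟩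
  rintro ⟨x, a⟩ s
  exact (runs_popSymbol none _).seq (by
    simpa [code, LeafTree.str] using (h x (by simp) a).2 s)

/-- Recursion along a list, for a function whose values stay small. -/
theorem foldl {f : α → β → γ → β} {l : α → List γ} {b : α → β} {q : α → ℕ}
    (hf : PolyTime A fun p : (α × β) × γ => f p.1.1 p.1.2 p.2) (hl : PolyTime A l)
    (hb : PolyTime A b) (hq : PolyBounded A q)
    (hlq : ∀ a l', l' <+: l a → TreeCode.size A (l'.foldl (f a) (b a)) ≤ q a) :
    PolyTime A fun a => (l a).foldl (f a) (b a) := by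
  -- The loop body acts on the remaining list, the parameter and the accumulator. Its value for an
  -- empty remaining list is never used.
  have hstep : PolyTime A fun p : List γ × α × β =>
      match p.1 with
      | [] => (([] : List γ), p.2)
      | c :: l => (l, p.2.1, f p.2.1 p.2.2 c) := by
    refine listCases (f := fun p => (([] : List γ), p))
      (g := fun x : (α × β) × γ × List γ => (x.2.2, x.1.1, f x.1.1 x.1.2 x.2.1))
      (pair (const _) .id) (pair PolyTime.snd.snd' (pair PolyTime.fst.fst' ?_))
    exact hf.comp (PolyTime.fst.pair PolyTime.snd.fst')
  obtain ⟨P, t, ⟨p, hp⟩, -, h⟩ := hstep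
  -- This bounds the size of every loop state: the remaining list is a sublist of `l a`, and the
  -- accumulator comes from a prefix of `l a`. Hence all rounds obey the same time bound `p.eval (Q
  -- a)`, up to the one step of the loop test.
  let Q : α → ℕ := fun a => 1 + TreeCode.size A (l a) + (1 + TreeCode.size A a + q a)
  have hQ : PolyBounded A Q := ((PolyBounded.const 1).add hl.size).add
    (((PolyBounded.const 1).add .size).add hq)
  have hrun : ∀ a (l₁ l₂ : List γ), l₁ ++ l₂ = l a → ∀ s,
      Runs (whileNode P) ((code (l₂, a, l₁.foldl (f a) (b a)) : LeafTree A).str ++ s)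
        ((code (([] : List γ), a, (l a).foldl (f a) (b a)) : LeafTree A).str ++ s)
        (l₂.length * (1 + p.eval (Q a)) + 1) := by
    intro a l₁ l₂
    induction l₂ generalizing l₁ with
    | nil =>
      rintro hl s
      rw [List.append_nil] at hl
      subst hl
      exact (runs_whileNode_halt none _).mono (by simp)
    | cons c l₂ ih =>
      intro hl s
      have h₁ := h (c :: l₂, a, l₁.foldl (f a) (b a)) s
      have h₂ := ih (l₁ ++ [c]) (by simpa using hl) s
      rw [List.foldl_append] at h₂
      refine (runs_whileNode_step h₁ h₂).mono ?_
      have ht : t (c :: l₂, a, l₁.foldl (f a) (b a)) ≤ p.eval (Q a) := by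
        refine (hp _).trans (p.eval_nat_mono ?_)
        have h₃ := hlq a l₁ ⟨_, hl⟩
        have h₄ : TreeCode.size A (c :: l₂) ≤ TreeCode.size A (l a) :=
          size_sublist (hl ▸ List.sublist_append_right _ _)
        simp only [size_pair, Q]
        omega
      simp only [List.length_cons, add_mul]
      omega
  have hwhile : PolyTime A fun p : α => (([] : List γ), p, (l p).foldl (f p) (b p)) := by
    obtain ⟨P', t', ht', hs', h'⟩ := hl.pair (PolyTime.id.pair hb)
    refine ⟨P'.seq (whileNode P), fun a => t' a + ((l a).length * (1 + p.eval (Q a)) + 1),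
      ht'.add (((hl.size.mono fun a => length_le_size _).mul ((PolyBounded.const 1).add
        (hQ.eval p))).add (.const 1)), (hQ.add (.const 2)).mono fun a => ?_,
      fun a s => (h' a s).seq (hrun a [] (l a) rfl s)⟩
    have := hlq a (l a) List.prefix_rfl
    simp only [size_pair, size_nil, Q]
    omega
  exact hwhile.snd'.snd'

end PolyTime

/-! ### Polynomial time functions on lists, numbers and truth values -/

open TreeCode

namespace PolyTime

variable {A : Type} {α β γ δ : Type} [TreeCode A α] [TreeCode A β] [TreeCode A γ] [TreeCode A δ]

/-- Two functions with the same trees as values. -/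
theorem congr_code {f : α → β} {g : α → γ} (hf : PolyTime A f)
    (h : ∀ a, (code (g a) : LeafTree A) = code (f a)) : PolyTime A g := by
  obtain ⟨P, t, ht, hs, hP⟩ := hf
  exact ⟨P, t, ht, hs.mono fun a => by simp [TreeCode.size, h], fun a s => by rw [h]; exact hP a s⟩

@[fun_prop]
theorem cons {f : α → γ} {g : α → List γ} (hf : PolyTime A f) (hg : PolyTime A g) :
    PolyTime A fun a => f a :: g a :=
  (hf.pair hg).congr_code fun _ => rfl

@[fun_prop]
theorem toList {f : α → Option γ} (hf : PolyTime A f) : PolyTime A fun a => (f a).toList :=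
  hf.congr_code fun _ => rfl

theorem of_toList {f : α → Option γ} (hf : PolyTime A fun a => (f a).toList) : PolyTime A f :=
  hf.congr_code fun _ => rfl

@[fun_prop]
theorem some {f : α → γ} (hf : PolyTime A f) : PolyTime A fun a => Option.some (f a) := by
  refine of_toList ?_
  change PolyTime A fun a => [f a]
  fun_prop

@[fun_prop]
theorem head? {f : α → List γ} (hf : PolyTime A f) : PolyTime A fun a => (f a).head? := by
  refine of_toList ?_
  refine PolyTime.comp (g := fun l : List γ => l.head?.toList) ?_ hf
  convert match_list (A := A) (l := fun l : List γ => l) (f := fun _ => ([] : List γ))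
    (g := fun p : List γ × γ × List γ => [p.2.1]) (by fun_prop) (by fun_prop) (by fun_prop) with l
  cases l <;> rfl

@[fun_prop]
theorem tail {f : α → List γ} (hf : PolyTime A f) : PolyTime A fun a => (f a).tail := by
  refine PolyTime.comp (g := fun l : List γ => l.tail) ?_ hf
  convert match_list (A := A) (l := fun l : List γ => l) (f := fun _ => ([] : List γ))
    (g := fun p : List γ × γ × List γ => p.2.2) (by fun_prop) (by fun_prop) (by fun_prop) with l
  cases l <;> rfl

theorem match_option {o : α → Option γ} {f : α → β} {g : α → γ → β} (ho : PolyTime A o)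
    (hf : PolyTime A f) (hg : PolyTime A fun p : α × γ => g p.1 p.2) :
    PolyTime A fun a =>
      match o a with
      | none => f a
      | Option.some c => g a c := by
  have := match_list (l := fun a => (o a).toList) (f := f)
    (g := fun p : α × γ × List γ => g p.1 p.2.1) (by fun_prop) hf (by fun_prop)
  convert this with a
  cases o a <;> rfl

@[fun_prop]
theorem getD {f : α → Option γ} (c : γ) (hf : PolyTime A f) : PolyTime A fun a => (f a).getD c := by
  convert match_option hf (f := fun _ => c) (g := fun _ c => c) (by fun_prop) (by fun_prop) with a
  cases f a <;> rfl

@[fun_prop]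
theorem decide_eq_none {f : α → Option γ} [∀ a, Decidable (f a = none)] (hf : PolyTime A f) :
    PolyTime A fun a => decide (f a = none) := by
  convert match_option hf (f := fun _ => true) (g := fun _ _ => false) (by fun_prop) (by fun_prop)
    with a
  split <;> simp [*]

@[fun_prop]
theorem ite {c : α → Prop} [∀ a, Decidable (c a)] {f g : α → β}
    (hc : PolyTime A fun a => decide (c a)) (hf : PolyTime A f) (hg : PolyTime A g) :
    PolyTime A fun a => if c a then f a else g a := by
  have hc' : PolyTime A fun a => if c a then [()] else [] :=
    hc.congr_code fun a => by by_cases h : c a <;> simp [h, code, listCode]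
  convert match_list hc' hg (g := fun p => f p.1) (by fun_prop) with a
  by_cases h : c a <;> simp [h]

@[fun_prop]
theorem decide_not {c : α → Prop} [∀ a, Decidable (c a)] (hc : PolyTime A fun a => decide (c a)) :
    PolyTime A fun a => decide (¬ c a) := by
  have : PolyTime A fun a => if c a then false else true := by fun_prop
  convert this with a
  by_cases h : c a <;> simp [h]

@[fun_prop]
theorem decide_and {c d : α → Prop} [∀ a, Decidable (c a)] [∀ a, Decidable (d a)]
    (hc : PolyTime A fun a => decide (c a)) (hd : PolyTime A fun a => decide (d a)) :
    PolyTime A fun a => decide (c a ∧ d a) := by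
  have : PolyTime A fun a => if c a then decide (d a) else false := by fun_prop
  convert this with a
  by_cases h : c a <;> simp [h]

/-- If the growth in one step does not depend on the accumulator, the growths merely add up along
the list, and all intermediate values stay polynomially small. -/
theorem foldl_of_le_add {f : α → β → γ → β} {l : α → List γ} {b : α → β} {r : α × γ → ℕ}
    (hf : PolyTime A fun p : (α × β) × γ => f p.1.1 p.1.2 p.2) (hl : PolyTime A l)
    (hb : PolyTime A b) (hr : PolyBounded A r)
    (h : ∀ a b c, TreeCode.size A (f a b c) ≤ TreeCode.size A b + r (a, c)) :
    PolyTime A fun a => (l a).foldl (f a) (b a) := by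
  obtain ⟨p, hp⟩ := hr
  refine foldl (q := fun a => TreeCode.size A (b a) + TreeCode.size A (l a) *
    p.eval (1 + TreeCode.size A a + TreeCode.size A (l a))) hf hl hb
    (hb.size.add (hl.size.mul ((((PolyBounded.const 1).add .size).add hl.size).eval p)))
    fun a l' hl' => ?_
  have key : ∀ (l' : List γ) (b : β), l' ⊆ l a → TreeCode.size A (l'.foldl (f a) b) ≤
      TreeCode.size A b + l'.length *
        p.eval (1 + TreeCode.size A a + TreeCode.size A (l a)) := by
    intro l'
    induction l' with
    | nil => simp
    | cons c l' ih =>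
      intro b hl'
      rw [List.cons_subset] at hl'
      refine (ih _ hl'.2).trans ?_
      have h₁ := h a b c
      have h₂ := (hp (a, c)).trans (p.eval_nat_mono
        (show _ ≤ 1 + TreeCode.size A a + TreeCode.size A (l a) by
          have := size_le_of_mem (A := A) hl'.1
          simp only [size_pair]; omega))
      simp only [List.length_cons, add_mul] at h₂ ⊢
      omega
  refine (key l' _ hl'.subset).trans ?_
  gcongr
  exact hl'.length_le.trans (length_le_size _)

@[fun_prop]
theorem reverse {f : α → List γ} (hf : PolyTime A f) : PolyTime A fun a => (f a).reverse := by
  have : PolyTime A fun a => (f a).foldl (fun l c => c :: l) [] :=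
    foldl_of_le_add (r := fun p : α × γ => 1 + TreeCode.size A p) (by fun_prop) hf (by fun_prop)
      ((PolyBounded.const 1).add .size) fun a b c => by simp; omega
  simpa using this

@[fun_prop]
theorem append {f g : α → List γ} (hf : PolyTime A f) (hg : PolyTime A g) :
    PolyTime A fun a => f a ++ g a := by
  have : PolyTime A fun a => (f a).reverse.foldl (fun l c => c :: l) (g a) :=
    foldl_of_le_add (r := fun p : α × γ => 1 + TreeCode.size A p) (by fun_prop) (by fun_prop) hg
      ((PolyBounded.const 1).add .size) fun a b c => by simp; omega
  simpa using this

@[fun_prop]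
theorem flatMap {f : α → γ → List δ} {l : α → List γ}
    (hf : PolyTime A fun p : α × γ => f p.1 p.2) (hl : PolyTime A l) :
    PolyTime A fun a => (l a).flatMap (f a) := by
  have : PolyTime A fun a => (l a).foldl (fun acc c => acc ++ f a c) [] :=
    foldl_of_le_add (r := fun p : α × γ => TreeCode.size A (f p.1 p.2))
      (by fun_prop) hl (by fun_prop) hf.size fun a b c => by
        have := size_append (A := A) b (f a c); dsimp only; omega
  convert this with a
  have key : ∀ (l : List γ) (b : List δ),
      l.foldl (fun acc c => acc ++ f a c) b = b ++ l.flatMap (f a) := by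
    intro l
    induction l with
    | nil => simp
    | cons c l ih => simp [ih]
  simp [key]

@[fun_prop]
theorem map {f : α → γ → δ} {l : α → List γ}
    (hf : PolyTime A fun p : α × γ => f p.1 p.2) (hl : PolyTime A l) :
    PolyTime A fun a => (l a).map (f a) := by
  have : PolyTime A fun a => (l a).flatMap fun c => [f a c] := by fun_prop
  simpa [List.map_eq_flatMap] using this

theorem decide_ne_nil {l : α → List γ} (hl : PolyTime A l) :
    PolyTime A fun a => decide (l a ≠ []) := by
  convert match_list hl (f := fun _ => false) (g := fun _ : α × γ × List γ => true) (by fun_prop)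
    (by fun_prop) with a
  cases l a <;> simp

@[fun_prop]
theorem filter {c : α → γ → Prop} [∀ a x, Decidable (c a x)] {l : α → List γ}
    (hc : PolyTime A fun p : α × γ => decide (c p.1 p.2)) (hl : PolyTime A l) :
    PolyTime A fun a => (l a).filter fun x => decide (c a x) := by
  have : PolyTime A fun a => (l a).flatMap fun x => if c a x then [x] else [] := by fun_prop
  convert this with a
  induction l a with
  | nil => rfl
  | cons x l ih => by_cases h : c a x <;> simp [h, ih]

@[fun_prop]
theorem find? {c : α → γ → Prop} [∀ a x, Decidable (c a x)] {l : α → List γ}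
    (hc : PolyTime A fun p : α × γ => decide (c p.1 p.2)) (hl : PolyTime A l) :
    PolyTime A fun a => (l a).find? fun x => decide (c a x) := by
  simp only [← List.head?_filter]
  fun_prop

@[fun_prop]
theorem product {f : α → List γ} {g : α → List δ} (hf : PolyTime A f) (hg : PolyTime A g) :
    PolyTime A fun a => f a ×ˢ g a := by
  change PolyTime A fun a => (f a).flatMap fun x => (g a).map fun y => (x, y)
  fun_prop

@[fun_prop]
theorem decide_exists_mem {c : α → γ → Prop} [∀ a x, Decidable (c a x)] {l : α → List γ}
    (hc : PolyTime A fun p : α × γ => decide (c p.1 p.2)) (hl : PolyTime A l) :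
    PolyTime A fun a => decide (∃ x ∈ l a, c a x) := by
  have : PolyTime A fun a => decide ((l a).filter (fun x => decide (c a x)) ≠ []) :=
    decide_ne_nil (by fun_prop)
  convert this with a
  simp [List.filter_eq_nil_iff]

@[fun_prop]
theorem length {l : α → List γ} (hl : PolyTime A l) : PolyTime A fun a => (l a).length := by
  have : PolyTime A fun a => (l a).map fun _ => () := by fun_prop
  exact this.congr_code fun a => by
    rw [List.map_const']
    rfl

@[fun_prop]
theorem replicate_unit {n : α → ℕ} (hn : PolyTime A n) :
    PolyTime A fun a => List.replicate (n a) () :=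
  hn.congr_code fun _ => rfl

@[fun_prop]
theorem succ {n : α → ℕ} (hn : PolyTime A n) : PolyTime A fun a => n a + 1 := by
  have : PolyTime A fun a => (() :: List.replicate (n a) ()).length := by fun_prop
  simpa using this

@[fun_prop]
theorem pred {n : α → ℕ} (hn : PolyTime A n) : PolyTime A fun a => n a - 1 := by
  have : PolyTime A fun a => (List.replicate (n a) ()).tail.length := by fun_prop
  simpa using this

theorem _root_.List.foldl_replicate_eq_iterate {α γ : Type} (f : α → α) (n : ℕ) (c : γ) (a : α) :
    (List.replicate n c).foldl (fun a _ => f a) a = f^[n] a := by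
  induction n generalizing a with
  | zero => rfl
  | succ n ih => simp [List.replicate_succ, ih]

/-- Iteration is a fold along a list of units, whose prefixes correspond to the smaller numbers of
iterations. -/
theorem iterate {f : α → β → β} {n : α → ℕ} {b : α → β} {q : α → ℕ}
    (hf : PolyTime A fun p : α × β => f p.1 p.2) (hn : PolyTime A n) (hb : PolyTime A b)
    (hq : PolyBounded A q) (h : ∀ a, ∀ i ≤ n a, TreeCode.size A ((f a)^[i] (b a)) ≤ q a) :
    PolyTime A fun a => (f a)^[n a] (b a) := by
  have : PolyTime A fun a => (List.replicate (n a) ()).foldl (fun x _ => f a x) (b a) := by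
    refine foldl (f := fun a x (_ : Unit) => f a x) ?_ (by fun_prop) hb hq fun a l' hl' => ?_
    · exact hf.comp (g := fun p : α × β => f p.1 p.2) (f := fun p : (α × β) × Unit => p.1)
        (by fun_prop)
    · obtain ⟨hl, hl''⟩ := List.prefix_replicate_iff.1 hl'
      rw [hl'', List.foldl_replicate_eq_iterate]
      exact h a _ hl
  simpa only [List.foldl_replicate_eq_iterate] using this

@[fun_prop]
theorem sub {m n : α → ℕ} (hm : PolyTime A m) (hn : PolyTime A n) :
    PolyTime A fun a => m a - n a := by
  have h : ∀ i k : ℕ, (fun k => k - 1)^[i] k = k - i := by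
    intro i
    induction i with
    | zero => simp
    | succ i ih => intro k; rw [Function.iterate_succ_apply, ih]; omega
  have := iterate (f := fun (_ : α) k => k - 1) (by fun_prop) hn hm hm.size fun a i _ => by
    rw [h, size_nat, size_nat]; omega
  simpa only [h] using this

@[fun_prop]
theorem decide_eq_nat {m n : α → ℕ} (hm : PolyTime A m) (hn : PolyTime A n) :
    PolyTime A fun a => decide (m a = n a) := by
  have h : ∀ {k : α → ℕ}, PolyTime A k → PolyTime A fun a => decide (k a ≠ 0) := fun {k} hk => by
    have : PolyTime A fun a => decide (List.replicate (k a) () ≠ []) := decide_ne_nil (by fun_prop)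
    simpa using this
  have : PolyTime A fun a => decide (¬ (m a - n a ≠ 0) ∧ ¬ (n a - m a ≠ 0)) :=
    decide_and (decide_not (h (by fun_prop))) (decide_not (h (by fun_prop)))
  convert this using 3 with a
  omega

@[fun_prop]
theorem decide_eq_pair {γ δ : Type} {f g : α → γ × δ} [DecidableEq γ] [DecidableEq δ]
    (h₁ : PolyTime A fun a => decide ((f a).1 = (g a).1))
    (h₂ : PolyTime A fun a => decide ((f a).2 = (g a).2)) :
    PolyTime A fun a => decide (f a = g a) := by
  simp only [Prod.ext_iff]
  fun_prop

@[fun_prop]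
theorem decide_eq_true {f : α → Bool} (hf : PolyTime A f) :
    PolyTime A fun a => decide (f a = true) := by
  simpa using hf

@[fun_prop]
theorem decide_eq_bool {f g : α → Bool} (hf : PolyTime A f) (hg : PolyTime A g) :
    PolyTime A fun a => decide (f a = g a) := by
  have : PolyTime A fun a => if f a = true then g a else decide (¬ g a = true) := by fun_prop
  convert this with a
  cases f a <;> cases g a <;> rfl

/-- Any function on a finite alphabet qualifies: it is a case distinction between constants. -/
theorem of_atom [Fintype A] {f : A → β} {g : α → A} (hg : PolyTime A g) :
    PolyTime A fun a => f (g a) :=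
  (of_forall_atom (f := fun x (_ : α) => f x) fun x => by fun_prop).comp
    (f := fun a => (g a, a)) (by fun_prop)

@[fun_prop]
theorem decide_eq_atom [Fintype A] [DecidableEq A] {f g : α → A} (hf : PolyTime A f)
    (hg : PolyTime A g) : PolyTime A fun a => decide (f a = g a) := by
  have := of_forall_atom (f := fun (x : A) (y : A) => decide (x = y)) fun x => of_atom .id
  exact this.comp (f := fun a => (f a, g a)) (by fun_prop)

@[fun_prop]
theorem range {n : α → ℕ} (hn : PolyTime A n) : PolyTime A fun a => List.range (n a) := by
  have h : ∀ i, (fun l : List ℕ => l ++ [l.length])^[i] [] = List.range i := by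
    intro i
    induction i with
    | zero => rfl
    | succ i ih => rw [Function.iterate_succ_apply', ih, List.length_range, List.range_succ]
  have := iterate (A := A) (f := fun (_ : α) l => l ++ [l.length]) (b := fun _ => [])
    (q := fun a => 1 + TreeCode.size A (n a) * (1 + TreeCode.size A (n a)))
    (by fun_prop) hn (by fun_prop)
    ((PolyBounded.const 1).add (hn.size.mul ((PolyBounded.const 1).add hn.size))) fun a i hi => by
      rw [h]
      have h₁ : ∀ k ∈ List.range i, TreeCode.size A k ≤ TreeCode.size A (n a) := by
        intro k hk
        rw [List.mem_range] at hk
        rw [size_nat, size_nat]; omega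
      refine (size_le_of_forall h₁).trans ?_
      have h₂ : i ≤ TreeCode.size A (n a) := by rw [size_nat]; omega
      rw [List.length_range]
      gcongr
  simpa only [h] using this

/-- The pairs of corresponding elements of two lists, and the rest of the second list. -/
def _root_.List.zipRest {γ δ : Type} (l : List γ) (l' : List δ) : List (γ × δ) × List δ :=
  (l.zip l', l'.drop l.length)

@[fun_prop]
theorem zipRest {f : α → List γ} {g : α → List δ} (hf : PolyTime A f) (hg : PolyTime A g) :
    PolyTime A fun a => (f a).zipRest (g a) := by
  -- The second list is part of the accumulator. An element that enters a pair leaves that list, so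
  -- the growth in one step is bounded in terms of `x` alone.
  let F : List (γ × δ) × List δ → γ → List (γ × δ) × List δ := fun p x =>
    (p.1 ++ p.2.head?.toList.map fun y => (x, y), p.2.tail)
  have hF : ∀ (l : List γ) (b : List (γ × δ)) (l' : List δ),
      l.foldl F (b, l') = (b ++ l.zip l', l'.drop l.length) := by
    intro l
    induction l with
    | nil => simp
    | cons x l ih =>
      rintro b (_ | ⟨y, l'⟩)
      · simp [F, ih]
      · simp [F, ih]
  have : PolyTime A fun a => (f a).foldl F ([], g a) := by
    refine foldl_of_le_add (f := fun _ => F) (r := fun p : α × γ => 1 + TreeCode.size A p)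
      (by fun_prop) hf (by fun_prop) ((PolyBounded.const 1).add .size) ?_
    rintro a ⟨b, _ | ⟨y, l⟩⟩ c
    · simp [F]
    · have := size_append (A := A) b [(c, y)]
      simp only [size_cons, size_pair, size_nil] at this
      simp only [F, List.head?_cons, Option.toList_some, List.map_cons, List.map_nil, List.tail_cons,
        size_pair, size_cons]
      omega
  simpa [hF, List.zipRest] using this

end PolyTime

/-! ### The algorithm -/

open TreeCode

namespace ClosestPair

/-! ### Saturation with one witness for each key -/

section stage

variable {ι κ : Type} [DecidableEq κ]

/-- For every key the first element of a list with this key. -/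
def select (key : ι → κ) (K : List κ) (L : List ι) : List ι :=
  K.flatMap fun k => (L.find? fun x => decide (key x = k)).toList

/-- Add to a list of elements those that are derived from it by a rule and have new keys. -/
def extend (key : ι → κ) (K : List κ) (rule : List ι → List ι) (S : List ι) : List ι :=
  select key K (S ++ rule S)

/-- The list that is obtained from `S` by extending it `i` times. -/
def stage (key : ι → κ) (K : List κ) (rule : List ι → List ι) (S : List ι) (i : ℕ) : List ι :=
  (extend key K rule)^[i] S

variable {key : ι → κ} {K : List κ} {rule : List ι → List ι} {S L : List ι} {x : ι} {i : ℕ}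

theorem stage_succ : stage key K rule S (i + 1) = extend key K rule (stage key K rule S i) :=
  Function.iterate_succ_apply' _ _ _

theorem mem_of_mem_select (h : x ∈ select key K L) : x ∈ L ∧ key x ∈ K := by
  simp only [select, List.mem_flatMap, Option.mem_toList] at h
  obtain ⟨k, hk, h⟩ := h
  have := List.find?_some h
  simp only [decide_eq_true_eq] at this
  exact ⟨List.mem_of_find?_eq_some h, this ▸ hk⟩

/-- However many elements a rule derives, at most one survives for each entry of `K`; this keeps the
stages short. -/
theorem length_select_le : (select key K L).length ≤ K.length := by
  induction K with
  | nil => simp [select]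
  | cons k K ih =>
    simp only [select, List.flatMap_cons, List.length_append, List.length_cons] at ih ⊢
    have : (L.find? fun x => decide (key x = k)).toList.length ≤ 1 := by
      cases L.find? fun x => decide (key x = k) <;> simp
    omega

/-- What holds for the initial elements, and for derived elements if it holds for those that they
are derived from, holds for all elements. -/
theorem forall_mem_stage {p : ℕ → ι → Prop} (h₀ : ∀ x ∈ S, p 0 x)
    (hmono : ∀ i x, p i x → p (i + 1) x)
    (hrule : ∀ i L, (∀ x ∈ L, p i x) → ∀ x ∈ rule L, key x ∈ K → p (i + 1) x) :
    ∀ x ∈ stage key K rule S i, p i x := by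
  induction i with
  | zero => exact h₀
  | succ i ih =>
    intro x hx
    rw [stage_succ, extend] at hx
    obtain ⟨hx, hk⟩ := mem_of_mem_select hx
    rcases List.mem_append.1 hx with hx | hx
    · exact hmono i x (ih x hx)
    · exact hrule i _ ih x hx hk

end stage

variable {A : Type} {α ι κ : Type} [TreeCode A α] [TreeCode A ι] [TreeCode A κ] [DecidableEq κ]

theorem polyTime_stage {key : ι → κ} {K : α → List κ} {rule : α → List ι → List ι}
    {S : α → List ι} {n B : α → ℕ} (hkey : PolyTime A key)
    (hκ : PolyTime A fun p : κ × κ => decide (p.1 = p.2)) (hK : PolyTime A K)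
    (hrule : PolyTime A fun p : α × List ι => rule p.1 p.2) (hS : PolyTime A S)
    (hn : PolyTime A n) (hB : PolyBounded A B)
    (h : ∀ a, ∀ i, i ≤ n a → ∀ x ∈ stage key (K a) (rule a) (S a) i, size A x ≤ B a) :
    PolyTime A fun a => stage key (K a) (rule a) (S a) (n a) := by
  -- Stage 0 is the unfiltered list `S a` and is accounted for separately; every later stage has at
  -- most as many elements as `K a`.
  refine PolyTime.iterate (q := fun a => size A (S a) + (1 + size A (K a) * (1 + B a))) ?_ hn hS
    (hS.size.add ((PolyBounded.const 1).add (hK.size.mul ((PolyBounded.const 1).add hB)))) ?_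
  · change PolyTime A fun p : α × List ι => (K p.1).flatMap fun k =>
      ((p.2 ++ rule p.1 p.2).find? fun x => decide (key x = k)).toList
    have : PolyTime A fun p : ((α × List ι) × κ) × ι => decide (key p.2 = p.1.2) :=
      hκ.comp (f := fun p : ((α × List ι) × κ) × ι => (key p.2, p.1.2)) (by fun_prop)
    fun_prop
  · intro a i hi
    have h₁ := size_le_of_forall (h a i hi)
    cases i with
    | zero => exact Nat.le_add_right _ _
    | succ i =>
      refine h₁.trans (Nat.le_add_left_of_le ?_)
      gcongr
      rw [stage_succ]
      exact length_select_le.trans (length_le_size _)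

/-! ### The graph of two automata and the search for a closest pair -/

/-- The states of two automata. -/
abbrev Vertex : Type := Bool × ℕ

/-- Labelled edges between the states of two automata. -/
abbrev Edge (A : Type) : Type := Vertex × A × Vertex

/-- The data of two automata: the states, the edges, the accepting states and the two initial
states. -/
abbrev Graph (A : Type) : Type := List Vertex × List (Edge A) × List Vertex × Vertex × Vertex

/-- A pair of states that can be reached by reading a pair of words. -/
abbrev Item (A : Type) : Type := (Vertex × Vertex) × (List A × List A)

variable [DecidableEq A] (inv : A → A)

/-- Compose pairs of states, and extend them by edges with inverse labels. -/
def cancelRule (edges : List (Edge A)) (S : List (Vertex × Vertex)) : List (Vertex × Vertex) :=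
  S.flatMap fun e =>
    (S.flatMap fun e' => if e.2 = e'.1 then [(e.1, e'.2)] else []) ++
    (edges.flatMap fun x => edges.flatMap fun y =>
      if x.2.2 = e.1 ∧ y.1 = e.2 ∧ y.2.1 = inv x.2.1 then [(x.1, y.2.2)] else [])

/-- The pairs of states of a graph. -/
def Graph.pairs (G : Graph A) : List (Vertex × Vertex) := G.1 ×ˢ G.1

/-- The pairs of states that are joined by a path with trivial label. -/
def Graph.trivialPairs (G : Graph A) : List (Vertex × Vertex) :=
  stage (fun e => e) (Graph.pairs G) (cancelRule inv G.2.1) (G.1.map fun v => (v, v))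
    (Graph.pairs G).length

/-- The edges, preceded by paths with trivial label. -/
def Graph.longEdges (G : Graph A) : List (Edge A) :=
  (Graph.trivialPairs inv G).flatMap fun e => G.2.1.flatMap fun x =>
    if x.1 = e.2 then [(e.1, x.2)] else []

/-- The states with a path with trivial label to an accepting state. -/
def Graph.nearAccept (G : Graph A) : List Vertex :=
  (Graph.trivialPairs inv G).flatMap fun e => G.2.2.1.flatMap fun f =>
    if e.2 = f then [e.1] else []

/-- Read the same letter on both sides. -/
def commonRule (edges : List (Edge A)) (S : List (Item A)) : List (Item A) :=
  S.flatMap fun t => edges.flatMap fun x => edges.flatMap fun y =>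
    if x.1 = t.1.1 ∧ y.1 = t.1.2 ∧ x.2.1 = y.2.1 then
      [((x.2.2, y.2.2), (t.2.1 ++ [x.2.1], t.2.2 ++ [x.2.1]))]
    else []

/-- Read a letter on one side. -/
def singleRule (edges : List (Edge A)) (S : List (Item A)) : List (Item A) :=
  S.flatMap fun t => edges.flatMap fun x =>
    (if x.1 = t.1.1 then [((x.2.2, t.1.2), (t.2.1 ++ [x.2.1], t.2.2))] else []) ++
    (if x.1 = t.1.2 then [((t.1.1, x.2.2), (t.2.1, t.2.2 ++ [x.2.1]))] else [])

/-- Pairs of states that are reached by reading a common word. -/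
def Graph.commonItems (G : Graph A) (i : ℕ) : List (Item A) :=
  stage Prod.fst (Graph.pairs G) (commonRule (Graph.longEdges inv G)) [(G.2.2.2, ([], []))] i

/-- Pairs of states that are reached by reading a common word, and then at most `i` letters on one
of the two sides. -/
def Graph.items (G : Graph A) (i : ℕ) : List (Item A) :=
  stage Prod.fst (Graph.pairs G) (singleRule (Graph.longEdges inv G))
    (Graph.commonItems inv G (Graph.pairs G).length) i

/-- The items in a list for which both states are accepting, up to paths with trivial label. -/
def Graph.final (G : Graph A) (S : List (Item A)) : List (Item A) :=
  S.filter fun t => decide ((∃ v ∈ Graph.nearAccept inv G, v = t.1.1) ∧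
    (∃ v ∈ Graph.nearAccept inv G, v = t.1.2))

/-- A closest pair of words. -/
def Graph.answer (G : Graph A) : Option (Item A) :=
  ((List.range ((Graph.pairs G).length + 1)).flatMap fun i =>
    Graph.final inv G (Graph.items inv G i)).head?

/-! ### The running time of the search -/

section polyTime

@[fun_prop]
theorem polyTime_pairs {A : Type} : PolyTime A (Graph.pairs (A := A)) := by
  unfold Graph.pairs; fun_prop

/-- Two empty words have size 3 as a pair, and a round adds one letter, of cost 2, to each word. The
graph need not be valid, so the initial states, which may be missing from `Graph.pairs G`, are
charged to `G` itself. -/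
theorem size_le_of_mem_commonItems (G : Graph A) (i : ℕ) :
    ∀ x ∈ Graph.commonItems inv G i, size A x.1 ≤ size A (Graph.pairs G) + size A G ∧
      size A x.2 ≤ 3 + 4 * i := by
  refine forall_mem_stage (p := fun i (x : Item A) => size A x.1 ≤ size A (Graph.pairs G) + size A G ∧
      size A x.2 ≤ 3 + 4 * i) ?_ (fun i (x : Item A) hx => ⟨hx.1, by omega⟩) ?_
  · obtain ⟨V, E, F, s⟩ := G
    intro x hx
    rw [List.mem_singleton] at hx
    subst hx
    simp only [size_pair, size_nil]
    omega
  · intro i L hL x hx hk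
    refine ⟨(size_le_of_mem hk).trans (Nat.le_add_right _ _), ?_⟩
    simp only [commonRule, List.mem_flatMap, List.mem_ite_nil_right, List.mem_singleton] at hx
    obtain ⟨y, hy, e, -, e', -, -, rfl⟩ := hx
    have h₁ := (hL y hy).2
    have h₂ := size_append (A := A) y.2.1 [e.2.1]
    have h₃ := size_append (A := A) y.2.2 [e.2.1]
    obtain ⟨k, u, v⟩ := y
    simp only [size_pair, size_cons, size_atom, size_nil] at *
    omega

/-- The term with the number of pairs pays for the common words. The summand `4 * i` is generous,
since a round adds a letter on only one side. -/
theorem size_le_of_mem_items (G : Graph A) (i : ℕ) :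
    ∀ x ∈ Graph.items inv G i, size A x.1 ≤ size A (Graph.pairs G) + size A G ∧
      size A x.2 ≤ 3 + 4 * (Graph.pairs G).length + 4 * i := by
  refine forall_mem_stage (p := fun i (x : Item A) => size A x.1 ≤ size A (Graph.pairs G) + size A G ∧
      size A x.2 ≤ 3 + 4 * (Graph.pairs G).length + 4 * i) ?_
      (fun i (x : Item A) hx => ⟨hx.1, by omega⟩) ?_
  · exact size_le_of_mem_commonItems inv G _
  · intro i L hL x hx hk
    refine ⟨(size_le_of_mem hk).trans (Nat.le_add_right _ _), ?_⟩
    simp only [singleRule, List.mem_flatMap, List.mem_append, List.mem_ite_nil_right,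
      List.mem_singleton] at hx
    obtain ⟨y, hy, e, -, ⟨-, rfl⟩ | ⟨-, rfl⟩⟩ := hx
    all_goals
      have h₁ := (hL y hy).2
      have h₂ := size_append (A := A) y.2.1 [e.2.1]
      have h₃ := size_append (A := A) y.2.2 [e.2.1]
      obtain ⟨k, u, v⟩ := y
      simp only [size_pair, size_cons, size_atom, size_nil] at *
      omega

variable [Fintype A]

@[fun_prop]
theorem polyTime_trivialPairs : PolyTime A (Graph.trivialPairs inv) := by
  have hinv : ∀ {α : Type} [TreeCode A α] {f : α → A}, PolyTime A f →
      PolyTime A fun a => inv (f a) := fun hf => PolyTime.of_atom hf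
  refine polyTime_stage (B := fun G => size A (Graph.pairs G) + size A (G.1.map fun v => (v, v)))
    (by fun_prop) (by fun_prop) (by fun_prop) ?_ (by fun_prop) (by fun_prop)
    (polyTime_pairs.size.add (PolyTime.size (by fun_prop))) ?_
  · unfold cancelRule
    fun_prop
  · intro G i hi x hx
    have := forall_mem_stage (p := fun _ x => x ∈ Graph.pairs G ∨ x ∈ G.1.map fun v => (v, v))
      (fun x hx => .inr hx) (fun i x hx => hx) (fun i L hL x hx hk => .inl hk) x hx
    rcases this with h | h
    · exact (size_le_of_mem h).trans (Nat.le_add_right _ _)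
    · exact (size_le_of_mem h).trans (Nat.le_add_left _ _)

@[fun_prop]
theorem polyTime_longEdges : PolyTime A (Graph.longEdges inv) := by
  unfold Graph.longEdges; fun_prop

@[fun_prop]
theorem polyTime_nearAccept : PolyTime A (Graph.nearAccept inv) := by
  unfold Graph.nearAccept; fun_prop

theorem polyBounded_pairs {A : Type} : PolyBounded A fun p : Graph A × ℕ =>
    1 + (size A (Graph.pairs p.1) + size A p.1) +
      (3 + 4 * (Graph.pairs p.1).length + 4 * p.2) := by
  have h₁ : PolyBounded A fun p : Graph A × ℕ => size A (Graph.pairs p.1) :=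
    PolyTime.size (by fun_prop)
  have h₂ : PolyBounded A fun p : Graph A × ℕ => size A p.1 := PolyTime.size (by fun_prop)
  have h₃ : PolyBounded A fun p : Graph A × ℕ => size A p.2 := PolyTime.size (by fun_prop)
  refine (((PolyBounded.const 1).add (h₁.add h₂)).add
    (((PolyBounded.const 3).add ((PolyBounded.const 4).mul h₁)).add
      ((PolyBounded.const 4).mul h₃))).mono fun p => ?_
  gcongr
  · exact length_le_size _
  · rw [size_nat]; omega

@[fun_prop]
theorem polyTime_commonItems {α : Type} [TreeCode A α] {G : α → Graph A} {n : α → ℕ}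
    (hG : PolyTime A G) (hn : PolyTime A n) :
    PolyTime A fun a => Graph.commonItems inv (G a) (n a) := by
  have hr : PolyTime A fun p : (Graph A × ℕ) × List (Item A) =>
      commonRule (Graph.longEdges inv p.1.1) p.2 := by
    unfold commonRule
    fun_prop
  have h := polyTime_stage (key := Prod.fst) (K := fun p : Graph A × ℕ => Graph.pairs p.1)
    (rule := fun p => commonRule (Graph.longEdges inv p.1))
    (S := fun p => [(p.1.2.2.2, ([], []))]) (n := fun p => p.2)
    (by fun_prop) (by fun_prop) (by fun_prop) hr (by fun_prop) (by fun_prop) polyBounded_pairs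
    fun p i hi x hx => by
      have h := size_le_of_mem_commonItems inv p.1 i x hx
      change size A (x.1, x.2) ≤ _
      rw [size_pair]
      omega
  exact h.comp (f := fun a => (G a, n a)) (by fun_prop)

@[fun_prop]
theorem polyTime_items {α : Type} [TreeCode A α] {G : α → Graph A} {n : α → ℕ}
    (hG : PolyTime A G) (hn : PolyTime A n) :
    PolyTime A fun a => Graph.items inv (G a) (n a) := by
  have hr : PolyTime A fun p : (Graph A × ℕ) × List (Item A) =>
      singleRule (Graph.longEdges inv p.1.1) p.2 := by
    unfold singleRule
    fun_prop
  have h := polyTime_stage (key := Prod.fst) (K := fun p : Graph A × ℕ => Graph.pairs p.1)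
    (rule := fun p => singleRule (Graph.longEdges inv p.1))
    (S := fun p => Graph.commonItems inv p.1 (Graph.pairs p.1).length) (n := fun p => p.2)
    (by fun_prop) (by fun_prop) (by fun_prop) hr (by fun_prop) (by fun_prop) polyBounded_pairs
    fun p i hi x hx => by
      have h := size_le_of_mem_items inv p.1 i x hx
      change size A (x.1, x.2) ≤ _
      rw [size_pair]
      omega
  exact h.comp (f := fun a => (G a, n a)) (by fun_prop)

@[fun_prop]
theorem polyTime_answer : PolyTime A (Graph.answer inv) := by
  unfold Graph.answer Graph.final
  fun_prop

end polyTime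

/-! ### Reading the input and writing the output -/

section strings

variable {A : Type}

/-- The numbers that are given by a string of bits, in unary. -/
def decodeNats (l : List Bool) : List ℕ :=
  (l.foldl (fun p b => if b = true then (p.1, p.2 + 1) else (p.1 ++ [p.2], 0))
    (([] : List ℕ), 0)).1

/-- The positions in the rows of the table of an automaton with `k` states: for every state the
position `none` for the acceptance bit and one position for every letter. -/
def slots (letters : List A) (k : ℕ) : List (ℕ × Option A) :=
  (List.range k).flatMap fun p => (none :: letters.map some).map fun x => (p, x)

/-- The number of states, the initial state and the entries of the table of an automaton, and the
rest of the list. -/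
def parse (letters : List A) (l : List ℕ) :
    ℕ × ℕ × List ((ℕ × Option A) × ℕ) × List ℕ :=
  -- The default values play no role for tables of automata, which always have these two entries.
  (l.head?.getD 0, l.tail.head?.getD 0, (slots letters (l.head?.getD 0)).zipRest l.tail.tail)

/-- The edges given by the entries of a table. -/
def tableEdges (t : Bool) (l : List ((ℕ × Option A) × ℕ)) : List (Edge A) :=
  l.flatMap fun e => e.1.2.toList.flatMap fun x =>
    if e.2 = 0 then [] else [((t, e.1.1), x, (t, e.2 - 1))]

/-- The accepting states given by the entries of a table. -/
def tableAccept (t : Bool) (l : List ((ℕ × Option A) × ℕ)) : List Vertex :=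
  l.flatMap fun e => if e.1.2 = none ∧ e.2 = 1 then [(t, e.1.1)] else []

/-- The graph given by the tables of two automata. -/
def toGraph (letters : List A) (l : List ℕ) : Graph A :=
  let p := parse letters l
  let q := parse letters p.2.2.2
  ((List.range p.1).map (fun v => (false, v)) ++ (List.range q.1).map (fun v => (true, v)),
    tableEdges false p.2.2.1 ++ tableEdges true q.2.2.1,
    tableAccept false p.2.2.1 ++ tableAccept true q.2.2.1,
    (false, p.2.1), (true, q.2.1))

/-- The answer as a string. -/
def outputString (o : Option (Item A)) : List (Option A) :=
  o.toList.flatMap fun t => t.2.1.map some ++ none :: t.2.2.map some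

/-- Leaves of trees. -/
def Leaf (A : Type) : Type := Option A

/-- As an element of `Option A`, an output symbol would be coded like a list; here it is a single
leaf, as `writeOutput` expects. -/
instance : TreeCode A (Leaf A) := ⟨fun o => .leaf o⟩

/-- The answer as a list of leaves of a tree. -/
def outputLeaves (o : Option (Item A)) : List (Leaf A) := outputString o

/-- A completed number moves from the second component into the list, so each bit enlarges the
accumulator only by a constant. -/
theorem polyTime_decodeNats : PolyTime A decodeNats := by
  refine PolyTime.fst' (PolyTime.foldl_of_le_add
    (f := fun (_ : List Bool) (p : List ℕ × ℕ) b =>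
      if b = true then (p.1, p.2 + 1) else (p.1 ++ [p.2], 0)) (r := fun _ => 3)
    (by fun_prop) (by fun_prop) (by fun_prop) (.const 3) ?_)
  rintro - ⟨l, k⟩ b
  have := size_append (A := A) l [k]
  cases b <;> simp [size_nat] at * <;> omega

theorem polyTime_toGraph (letters : List A) : PolyTime A (toGraph letters) := by
  have h : PolyTime A (parse letters) := by
    unfold parse slots
    fun_prop
  have h₁ : ∀ t, PolyTime A (tableEdges (A := A) t) := fun t => by unfold tableEdges; fun_prop
  have h₂ : ∀ t, PolyTime A (tableAccept (A := A) t) := fun t => by unfold tableAccept; fun_prop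
  unfold toGraph
  fun_prop

theorem polyTime_outputLeaves : PolyTime A (outputLeaves (A := A)) := by
  have h : PolyTime (β := Leaf A) A fun x : A => some x := PolyTime.of_code_eq fun _ => rfl
  have h' : PolyTime (β := List (Leaf A)) A fun o : Option (Item A) =>
      o.toList.flatMap (β := Leaf A) fun t => t.2.1.map (β := Leaf A) (fun x => some x) ++
        List.cons (α := Leaf A) none (t.2.2.map (β := Leaf A) fun x => some x) := by
    fun_prop
  exact h'

end strings

end ClosestPair

/-! ### Correctness of the algorithm -/

namespace ClosestPair

/-! ### Completeness of saturation -/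

section stage

variable {ι κ : Type} [DecidableEq κ] {key : ι → κ} {K : List κ} {rule : List ι → List ι}
  {S L : List ι} {x : ι} {i : ℕ}

theorem exists_mem_select (hx : x ∈ L) (hk : key x ∈ K) : ∃ y ∈ select key K L, key y = key x := by
  have h : (L.find? fun y => decide (key y = key x)).isSome := by
    rw [List.find?_isSome]
    exact ⟨x, hx, by simp⟩
  obtain ⟨y, hy⟩ := Option.isSome_iff_exists.1 h
  refine ⟨y, ?_, by simpa using List.find?_some hy⟩
  simp only [select, List.mem_flatMap, Option.mem_toList]
  exact ⟨_, hk, hy⟩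

theorem exists_mem_stage_succ_of_rule (hx : x ∈ rule (stage key K rule S i)) (hk : key x ∈ K) :
    ∃ y ∈ stage key K rule S (i + 1), key y = key x := by
  rw [stage_succ]
  exact exists_mem_select (List.mem_append_right _ hx) hk

theorem key_mem_of_mem_stage (hS : ∀ x ∈ S, key x ∈ K) (hx : x ∈ stage key K rule S i) :
    key x ∈ K :=
  forall_mem_stage (p := fun _ x => key x ∈ K) hS (fun _ _ h => h) (fun _ _ _ _ _ h => h) x hx

/-- Only keys are claimed to persist, not elements. The assumption `hS` is there because the initial
list has not been filtered by `K`. -/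
theorem exists_mem_stage_succ (hS : ∀ x ∈ S, key x ∈ K) (hx : x ∈ stage key K rule S i) :
    ∃ y ∈ stage key K rule S (i + 1), key y = key x := by
  rw [stage_succ]
  exact exists_mem_select (List.mem_append_left _ hx) (key_mem_of_mem_stage hS hx)

theorem exists_mem_stage_of_le (hS : ∀ x ∈ S, key x ∈ K) {j : ℕ} (hij : i ≤ j)
    (hx : x ∈ stage key K rule S i) : ∃ y ∈ stage key K rule S j, key y = key x := by
  induction j, hij using Nat.le_induction with
  | base => exact ⟨x, hx, rfl⟩
  | succ j _ ih =>
    obtain ⟨y, hy, hyx⟩ := ih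
    obtain ⟨z, hz, hzy⟩ := exists_mem_stage_succ hS hy
    exact ⟨z, hz, hzy.trans hyx⟩

/-- An increasing sequence of subsets of a finite set that is constant as soon as two consecutive
terms agree. -/
theorem _root_.Finset.eq_of_chain {κ : Type} {F : ℕ → Finset κ} {n : ℕ}
    (hmono : ∀ i, F i ⊆ F (i + 1)) (hstable : ∀ i, F (i + 1) = F i → F (i + 2) = F (i + 1))
    (hcard : ∀ i, (F i).card ≤ n) (j : ℕ) : F (n + j) = F n := by
  have h : F (n + 1) = F n := by
    by_contra h
    -- An equality at an earlier index would propagate up to `n`, so all inclusions up to `n` are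
    -- strict. Then `F (n + 1)` has at least `n + 1` elements, too many. Truncated subtraction makes
    -- the claim repeat itself once `i` exceeds `n`.
    have hne : ∀ i, F (n - i + 1) ≠ F (n - i) := by
      intro i
      induction i with
      | zero => exact h
      | succ i ih =>
        by_cases hi : n ≤ i
        · rwa [Nat.sub_eq_zero_of_le (Nat.le_succ_of_le hi), ← Nat.sub_eq_zero_of_le hi]
        · intro h'
          have := hstable _ h'
          rw [show n - (i + 1) + 2 = n - i + 1 by omega,
            show n - (i + 1) + 1 = n - i by omega] at this
          exact ih this
    have hlt : ∀ i ≤ n + 1, i ≤ (F i).card := by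
      intro i
      induction i with
      | zero => simp
      | succ i ih =>
        intro hi
        have h₁ := ih (by omega)
        have h₂ := hne (n - i)
        rw [show n - (n - i) = i by omega] at h₂
        have := Finset.card_lt_card ((hmono i).ssubset_of_ne h₂.symm)
        omega
    have := hlt (n + 1) le_rfl
    have := hcard (n + 1)
    omega
  have h' : ∀ j, F (n + j + 1) = F (n + j) := by
    intro j
    induction j with
    | zero => exact h
    | succ j ih => exact hstable _ ih
  induction j with
  | zero => rfl
  | succ j ih => exact (h' j).trans ih

/-- If the keys of the derived elements depend only on the keys of the given elements, then there
are no new keys after as many extensions as there are keys. -/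
theorem exists_mem_stage_length (hS : ∀ x ∈ S, key x ∈ K)
    (hrule : ∀ L L' : List ι, (∀ x ∈ L, ∃ y ∈ L', key y = key x) →
      ∀ x ∈ rule L, ∃ y ∈ rule L', key y = key x)
    (hx : x ∈ stage key K rule S i) : ∃ y ∈ stage key K rule S K.length, key y = key x := by
  let F : ℕ → Finset κ := fun i => ((stage key K rule S i).map key).toFinset
  have hF : ∀ i k, k ∈ F i ↔ ∃ x ∈ stage key K rule S i, key x = k := by simp [F]
  have hsub : ∀ i, F i ⊆ K.toFinset := by
    intro i k hk
    obtain ⟨x, hx, rfl⟩ := (hF i k).1 hk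
    exact List.mem_toFinset.2 (key_mem_of_mem_stage hS hx)
  have hmono : ∀ i, F i ⊆ F (i + 1) := by
    intro i k hk
    obtain ⟨x, hx, rfl⟩ := (hF i k).1 hk
    exact (hF _ _).2 (exists_mem_stage_succ hS hx)
  rcases le_total i K.length with h | h
  · exact exists_mem_stage_of_le hS h hx
  · obtain ⟨j, rfl⟩ := Nat.exists_eq_add_of_le h
    refine (hF _ _).1 ?_
    rw [← Finset.eq_of_chain hmono ?_ (fun i => (Finset.card_le_card (hsub i)).trans
      (List.toFinset_card_le K)) j]
    · exact (hF _ _).2 ⟨x, hx, rfl⟩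
    -- If stages `i` and `i + 1` have the same keys, every key derived from stage `i + 1` is already
    -- derived from stage `i`, and so occurs in stage `i + 1`.
    · intro i hi
      refine Finset.Subset.antisymm (fun k hk => ?_) (hmono _)
      obtain ⟨x, hx, rfl⟩ := (hF _ _).1 hk
      rw [stage_succ, extend] at hx
      obtain ⟨hx, hk⟩ := mem_of_mem_select hx
      rcases List.mem_append.1 hx with hx | hx
      · exact (hF _ _).2 ⟨x, hx, rfl⟩
      · obtain ⟨y, hy, hyx⟩ := hrule _ (stage key K rule S i) (fun z hz =>
          (hF _ _).1 (hi ▸ (hF _ _).2 ⟨z, hz, rfl⟩)) x hx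
        exact (hF _ _).2 (hyx ▸ exists_mem_stage_succ_of_rule hy (hyx ▸ hk))

end stage

/-! ### Paths with trivial label and the reading of reduced words -/

variable {ι : Type}

/-- The inverse of a letter. -/
def flip (x : ι × Bool) : ι × Bool := (x.1, !x.2)

/-- There is a path from `p` to `q` with label `w`. -/
def Path (edges : List (Edge (ι × Bool))) : Vertex → List (ι × Bool) → Vertex → Prop
  | p, [], q => p = q
  | p, x :: w, q => ∃ r, (p, x, r) ∈ edges ∧ Path edges r w q

theorem Path.append {edges : List (Edge (ι × Bool))} {p q r : Vertex} {u v : List (ι × Bool)}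
    (h : Path edges p u q) (h' : Path edges q v r) : Path edges p (u ++ v) r := by
  induction u generalizing p with
  | nil => cases h; exact h'
  | cons x u ih =>
    obtain ⟨s, hs, h⟩ := h
    exact ⟨s, hs, ih h⟩

variable [DecidableEq ι]

/-- All initial states and the ends of all edges are states. -/
structure Graph.Valid (G : Graph (ι × Bool)) : Prop where
  edge : ∀ e ∈ G.2.1, e.1 ∈ G.1 ∧ e.2.2 ∈ G.1
  start : G.2.2.2.1 ∈ G.1 ∧ G.2.2.2.2 ∈ G.1

/-- The elements represented by the labels of the paths from `s` to accepting states. -/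
def Graph.elements (G : Graph (ι × Bool)) (s : Vertex) : Set (FreeGroup ι) :=
  {g | ∃ w, ∃ f ∈ G.2.2.1, Path G.2.1 s w f ∧ FreeGroup.mk w = g}

/-- The word `w` can be read from `p` to a nearly accepting state, along edges preceded by paths
with trivial label. -/
def Reads (G : Graph (ι × Bool)) : Vertex → List (ι × Bool) → Prop
  | p, [] => p ∈ Graph.nearAccept flip G
  | p, x :: w => ∃ q, (p, x, q) ∈ Graph.longEdges flip G ∧ Reads G q w

variable {G : Graph (ι × Bool)}

theorem mem_pairs {ι : Type} {G : Graph (ι × Bool)} {p q : Vertex} : (p, q) ∈ Graph.pairs G ↔ p ∈ G.1 ∧ q ∈ G.1 := by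
  simp [Graph.pairs]

theorem mem_longEdges {p q : Vertex} {x : ι × Bool} : (p, x, q) ∈ Graph.longEdges flip G ↔
    ∃ r, (p, r) ∈ Graph.trivialPairs flip G ∧ (r, x, q) ∈ G.2.1 := by
  simp only [Graph.longEdges, List.mem_flatMap, List.mem_ite_nil_right, List.mem_singleton]
  constructor
  · rintro ⟨⟨a, b⟩, h₁, ⟨c, y, d⟩, h₂, h₃, h₄⟩
    cases h₄; cases h₃
    exact ⟨_, h₁, h₂⟩
  · rintro ⟨r, h₁, h₂⟩
    exact ⟨_, h₁, _, h₂, rfl, rfl⟩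

theorem mem_nearAccept {p : Vertex} : p ∈ Graph.nearAccept flip G ↔
    ∃ f ∈ G.2.2.1, (p, f) ∈ Graph.trivialPairs flip G := by
  simp only [Graph.nearAccept, List.mem_flatMap, List.mem_ite_nil_right, List.mem_singleton]
  constructor
  · rintro ⟨⟨a, b⟩, h₁, f, h₂, h₃, h₄⟩
    cases h₄; cases h₃
    exact ⟨_, h₂, h₁⟩
  · rintro ⟨f, h₁, h₂⟩
    exact ⟨_, h₂, _, h₁, rfl, rfl⟩

theorem mem_cancelRule {edges : List (Edge (ι × Bool))} {S : List (Vertex × Vertex)}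
    {p q : Vertex} : (p, q) ∈ cancelRule flip edges S ↔
      (∃ r, (p, r) ∈ S ∧ (r, q) ∈ S) ∨
      ∃ x r s, (p, x, r) ∈ edges ∧ (r, s) ∈ S ∧ (s, flip x, q) ∈ edges := by
  simp only [cancelRule, List.mem_flatMap, List.mem_append, List.mem_ite_nil_right,
    List.mem_singleton]
  constructor
  · rintro ⟨⟨a, b⟩, h₁, ⟨⟨c, d⟩, h₂, h₃, h₄⟩ | ⟨⟨c, y, d⟩, h₂, ⟨c', y', d'⟩, h₃, ⟨h₄, h₅, h₆⟩, h₇⟩⟩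
    · cases h₃; cases h₄
      exact .inl ⟨_, h₁, h₂⟩
    · cases h₄; cases h₅; cases h₆; cases h₇
      exact .inr ⟨_, _, _, h₂, h₁, h₃⟩
  · rintro (⟨r, h₁, h₂⟩ | ⟨x, r, s, h₁, h₂, h₃⟩)
    · exact ⟨_, h₁, .inl ⟨_, h₂, rfl, rfl⟩⟩
    · exact ⟨_, h₂, .inr ⟨_, h₁, _, h₃, ⟨rfl, rfl, rfl⟩, rfl⟩⟩

theorem mk_cons {ι : Type} (x : ι × Bool) (w : List (ι × Bool)) :
    FreeGroup.mk (x :: w) = FreeGroup.mk [x] * FreeGroup.mk w := by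
  rw [FreeGroup.mul_mk]; rfl

theorem mk_flip {ι : Type} (x : ι × Bool) : FreeGroup.mk [flip x] = (FreeGroup.mk [x])⁻¹ := by
  rw [FreeGroup.inv_mk]; rfl

/-- Soundness of saturation: a product of trivial labels is trivial, and so is the conjugate of a
trivial label by a letter. -/
theorem exists_path_of_mem_trivialPairs {e : Vertex × Vertex}
    (h : e ∈ Graph.trivialPairs flip G) :
    ∃ w, Path G.2.1 e.1 w e.2 ∧ FreeGroup.mk w = 1 := by
  refine forall_mem_stage (p := fun _ (e : Vertex × Vertex) => ∃ w, Path G.2.1 e.1 w e.2 ∧ FreeGroup.mk w = 1)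
    ?_ (fun _ _ h => h) ?_ e h
  · intro e he
    obtain ⟨v, -, rfl⟩ := List.mem_map.1 he
    exact ⟨[], rfl, rfl⟩
  · rintro - L hL ⟨p, q⟩ he -
    rcases mem_cancelRule.1 he with ⟨r, h₁, h₂⟩ | ⟨x, r, s, h₁, h₂, h₃⟩
    · obtain ⟨u, hu, hu'⟩ := hL _ h₁
      obtain ⟨v, hv, hv'⟩ := hL _ h₂
      exact ⟨u ++ v, hu.append hv, by rw [← FreeGroup.mul_mk, hu', hv', one_mul]⟩
    · obtain ⟨u, hu, hu'⟩ := hL _ h₂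
      refine ⟨x :: (u ++ [flip x]), ⟨r, h₁, hu.append ⟨q, h₃, rfl⟩⟩, ?_⟩
      rw [mk_cons, ← FreeGroup.mul_mk, hu', mk_flip, one_mul, mul_inv_cancel]

/-- Each trivial pair is expanded to an actual path. The accepted word differs from `w` only by
inserted words that represent 1. -/
theorem mk_mem_elements_of_reads {p : Vertex} {w : List (ι × Bool)} (h : Reads G p w) :
    FreeGroup.mk w ∈ Graph.elements G p := by
  induction w generalizing p with
  | nil =>
    obtain ⟨f, hf, h⟩ := mem_nearAccept.1 h
    obtain ⟨u, hu, hu'⟩ := exists_path_of_mem_trivialPairs h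
    exact ⟨u, f, hf, hu, hu'⟩
  | cons x w ih =>
    obtain ⟨q, hq, h⟩ := h
    obtain ⟨r, hr, hq⟩ := mem_longEdges.1 hq
    obtain ⟨v, f, hf, hv, hv'⟩ := ih h
    obtain ⟨u, hu, hu'⟩ := exists_path_of_mem_trivialPairs hr
    refine ⟨u ++ x :: v, f, hf, hu.append ⟨q, hq, hv⟩, ?_⟩
    rw [← FreeGroup.mul_mk, hu', one_mul, mk_cons, hv', ← mk_cons]

namespace Graph.Valid

/-- The rule is monotone and every pair is its own key, so as many rounds as there are pairs reach a
set closed under the rule. -/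
theorem mem_trivialPairs_of_rule {e : Vertex × Vertex}
    (h : e ∈ cancelRule flip G.2.1 (Graph.trivialPairs flip G)) (he : e ∈ Graph.pairs G) :
    e ∈ Graph.trivialPairs flip G := by
  have hS : ∀ e ∈ G.1.map fun v => (v, v), e ∈ Graph.pairs G := by
    intro e he
    obtain ⟨v, hv, rfl⟩ := List.mem_map.1 he
    exact mem_pairs.2 ⟨hv, hv⟩
  have hrule : ∀ L L' : List (Vertex × Vertex), (∀ x ∈ L, ∃ y ∈ L', y = x) →
      ∀ x ∈ cancelRule flip G.2.1 L, ∃ y ∈ cancelRule flip G.2.1 L', y = x := by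
    rintro L L' h ⟨p, q⟩ he
    have h' : ∀ x ∈ L, x ∈ L' := fun x hx => by
      obtain ⟨y, hy, rfl⟩ := h x hx
      exact hy
    refine ⟨(p, q), ?_, rfl⟩
    rcases mem_cancelRule.1 he with ⟨r, h₁, h₂⟩ | ⟨x, r, s, h₁, h₂, h₃⟩
    · exact mem_cancelRule.2 (.inl ⟨r, h' _ h₁, h' _ h₂⟩)
    · exact mem_cancelRule.2 (.inr ⟨x, r, s, h₁, h' _ h₂, h₃⟩)
  obtain ⟨y, hy, rfl⟩ := exists_mem_stage_succ_of_rule (key := fun e => e) h he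
  obtain ⟨z, hz, rfl⟩ := exists_mem_stage_length (key := fun e => e) hS hrule hy
  exact hz

theorem mem_pairs_of_mem_trivialPairs {e : Vertex × Vertex}
    (h : e ∈ Graph.trivialPairs flip G) : e ∈ Graph.pairs G := by
  refine key_mem_of_mem_stage (key := fun e => e) ?_ h
  intro e he
  obtain ⟨v, hv, rfl⟩ := List.mem_map.1 he
  exact mem_pairs.2 ⟨hv, hv⟩

theorem trivialPairs_refl {p : Vertex} (hp : p ∈ G.1) : (p, p) ∈ Graph.trivialPairs flip G := by
  obtain ⟨y, hy, rfl⟩ := exists_mem_stage_of_le (key := fun e => e) (K := Graph.pairs G)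
    (rule := cancelRule flip G.2.1) (S := G.1.map fun v => (v, v)) (i := 0) (x := (p, p))
    (fun e he => by
      obtain ⟨v, hv, rfl⟩ := List.mem_map.1 he
      exact mem_pairs.2 ⟨hv, hv⟩) (Nat.zero_le (Graph.pairs G).length)
    (List.mem_map.2 ⟨p, hp, rfl⟩)
  exact hy

theorem trivialPairs_trans {p q r : Vertex}
    (h : (p, q) ∈ Graph.trivialPairs flip G) (h' : (q, r) ∈ Graph.trivialPairs flip G) :
    (p, r) ∈ Graph.trivialPairs flip G :=
  mem_trivialPairs_of_rule (mem_cancelRule.2 (.inl ⟨q, h, h'⟩))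
    (mem_pairs.2 ⟨(mem_pairs.1 (mem_pairs_of_mem_trivialPairs h)).1,
      (mem_pairs.1 (mem_pairs_of_mem_trivialPairs h')).2⟩)

theorem trivialPairs_conj (hG : Graph.Valid G) {p q r s : Vertex} {x : ι × Bool}
    (h : (p, x, q) ∈ G.2.1) (h' : (q, r) ∈ Graph.trivialPairs flip G)
    (h'' : (r, flip x, s) ∈ G.2.1) : (p, s) ∈ Graph.trivialPairs flip G :=
  mem_trivialPairs_of_rule (mem_cancelRule.2 (.inr ⟨x, q, r, h, h', h''⟩))
    (mem_pairs.2 ⟨(hG.edge _ h).1, (hG.edge _ h'').2⟩)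

theorem reads_of_trivialPair {p q : Vertex} {w : List (ι × Bool)}
    (h : (p, q) ∈ Graph.trivialPairs flip G) (hq : Reads G q w) : Reads G p w := by
  cases w with
  | nil =>
    obtain ⟨f, hf, hq⟩ := mem_nearAccept.1 hq
    exact mem_nearAccept.2 ⟨f, hf, trivialPairs_trans h hq⟩
  | cons x w =>
    obtain ⟨r, hr, hw⟩ := hq
    obtain ⟨s, hs, hr⟩ := mem_longEdges.1 hr
    exact ⟨r, mem_longEdges.2 ⟨s, trivialPairs_trans h hs, hr⟩, hw⟩

theorem reads_of_path (hG : Graph.Valid G) {p f : Vertex} {w : List (ι × Bool)}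
    (h : Path G.2.1 p w f) (hp : p ∈ G.1) (hf : f ∈ G.2.2.1) : Reads G p w := by
  induction w generalizing p with
  | nil =>
    cases h
    exact mem_nearAccept.2 ⟨_, hf, trivialPairs_refl hp⟩
  | cons x w ih =>
    obtain ⟨q, hq, h⟩ := h
    exact ⟨q, mem_longEdges.2 ⟨p, trivialPairs_refl hp, hq⟩, ih h (hG.edge _ hq).2⟩

/-- The central step of Benois' argument. The edge for x, the trivial pair before the edge for x⁻¹,
and that edge together form a trivial pair; it is absorbed by whatever is read next, or by
acceptance. -/
theorem reads_cancel (hG : Graph.Valid G) {p : Vertex} {x : ι × Bool} {u v : List (ι × Bool)}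
    (h : Reads G p (u ++ x :: flip x :: v)) : Reads G p (u ++ v) := by
  induction u generalizing p with
  | nil =>
    obtain ⟨q, hq, r, hr, h⟩ := h
    obtain ⟨q', hq', hq⟩ := mem_longEdges.1 hq
    obtain ⟨r', hr', hr⟩ := mem_longEdges.1 hr
    exact reads_of_trivialPair (trivialPairs_trans hq' (hG.trivialPairs_conj hq hr' hr)) h
  | cons y u ih =>
    obtain ⟨q, hq, h⟩ := h
    exact ⟨q, hq, ih h⟩

theorem reads_of_red (hG : Graph.Valid G) {p : Vertex} {u v : List (ι × Bool)}
    (hr : FreeGroup.Red u v) (h : Reads G p u) : Reads G p v := by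
  induction hr with
  | refl => exact h
  | tail _ hs ih =>
    cases hs with
    | not => exact hG.reads_cancel ih

/-- The reduced words of the elements given by an automaton can be read. -/
theorem reads_toWord (hG : Graph.Valid G) {p : Vertex} (hp : p ∈ G.1) {g : FreeGroup ι}
    (h : g ∈ Graph.elements G p) : Reads G p g.toWord := by
  obtain ⟨w, f, hf, h, rfl⟩ := h
  rw [FreeGroup.toWord_mk]
  exact hG.reads_of_red FreeGroup.reduce.red (hG.reads_of_path h hp hf)

end Graph.Valid

end ClosestPair

/-! ### Distances and the correctness of the search -/

namespace ClosestPair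

/-- Two reduced words split into a common prefix and rests whose lengths add up to the distance of
the elements that they represent. -/
theorem exists_common_prefix {ι : Type} [DecidableEq ι] (u v : List (ι × Bool))
    (hu : FreeGroup.IsReduced u) (hv : FreeGroup.IsReduced v) :
    ∃ c a b, u = c ++ a ∧ v = c ++ b ∧
      ((FreeGroup.mk u)⁻¹ * FreeGroup.mk v).norm = a.length + b.length := by
  induction u generalizing v with
  | nil =>
    refine ⟨[], [], v, rfl, rfl, ?_⟩
    change ((1 : FreeGroup ι)⁻¹ * _).norm = _
    rw [inv_one, one_mul, FreeGroup.norm, FreeGroup.toWord_mk, hv.reduce_eq]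
    simp
  | cons x u ih =>
    cases v with
    | nil =>
      refine ⟨[], x :: u, [], rfl, rfl, ?_⟩
      change (_ * (1 : FreeGroup ι)).norm = _
      rw [mul_one, FreeGroup.norm_inv_eq, FreeGroup.norm, FreeGroup.toWord_mk, hu.reduce_eq]
      simp
    | cons y v =>
      by_cases hxy : x = y
      · subst hxy
        obtain ⟨c, a, b, h₁, h₂, h⟩ := ih v (hu.infix ⟨[x], [], by simp⟩)
          (hv.infix ⟨[x], [], by simp⟩)
        refine ⟨x :: c, a, b, by simp [h₁], by simp [h₂], ?_⟩
        rw [mk_cons x u, mk_cons x v, ← h]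
        congr 1
        group
      · refine ⟨[], x :: u, y :: v, rfl, rfl, ?_⟩
        -- Both factors are reduced, and at the junction x⁻¹ meets y ≠ x, so nothing cancels.
        have hr : FreeGroup.IsReduced (FreeGroup.invRev (x :: u) ++ y :: v) := by
          have h₁ : FreeGroup.IsReduced (FreeGroup.invRev (x :: u)) := by
            rw [FreeGroup.isReduced_iff_reduce_eq, FreeGroup.reduce_invRev, hu.reduce_eq]
          refine List.IsChain.append h₁ hv ?_
          intro s hs t ht
          simp only [FreeGroup.invRev, List.map_cons, List.reverse_cons, List.getLast?_append,
            List.getLast?_singleton, Option.some_or, Option.mem_def, Option.some.injEq,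
            List.head?_cons] at hs ht
          subst hs ht
          intro h
          obtain ⟨i, b⟩ := x
          obtain ⟨j, b'⟩ := y
          simp only at h
          subst h
          cases b <;> cases b' <;> simp_all
        rw [FreeGroup.inv_mk, FreeGroup.mul_mk, FreeGroup.norm, FreeGroup.toWord_mk, hr.reduce_eq]
        simp

variable {ι : Type}

theorem mem_commonRule [DecidableEq ι] {edges : List (Edge (ι × Bool))}
    {S : List (Item (ι × Bool))} {s : Item (ι × Bool)} : s ∈ commonRule edges S ↔
      ∃ t ∈ S, ∃ x p q, (t.1.1, x, p) ∈ edges ∧ (t.1.2, x, q) ∈ edges ∧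
        s = ((p, q), (t.2.1 ++ [x], t.2.2 ++ [x])) := by
  simp only [commonRule, List.mem_flatMap, List.mem_ite_nil_right, List.mem_singleton]
  constructor
  · rintro ⟨t, ht, ⟨p, x, p'⟩, h₁, ⟨q, y, q'⟩, h₂, ⟨h₃, h₄, h₅⟩, rfl⟩
    cases h₃; cases h₄; cases h₅
    exact ⟨t, ht, _, _, _, h₁, h₂, rfl⟩
  · rintro ⟨t, ht, x, p, q, h₁, h₂, rfl⟩
    exact ⟨t, ht, _, h₁, _, h₂, ⟨rfl, rfl, rfl⟩, rfl⟩

theorem mem_singleRule {edges : List (Edge (ι × Bool))}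
    {S : List (Item (ι × Bool))} {s : Item (ι × Bool)} : s ∈ singleRule edges S ↔
      ∃ t ∈ S, ∃ x r, ((t.1.1, x, r) ∈ edges ∧ s = ((r, t.1.2), (t.2.1 ++ [x], t.2.2))) ∨
        ((t.1.2, x, r) ∈ edges ∧ s = ((t.1.1, r), (t.2.1, t.2.2 ++ [x]))) := by
  simp only [singleRule, List.mem_flatMap, List.mem_append, List.mem_ite_nil_right,
    List.mem_singleton]
  constructor
  · rintro ⟨t, ht, ⟨p, x, p'⟩, h, ⟨h₁, rfl⟩ | ⟨h₁, rfl⟩⟩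
    · cases h₁
      exact ⟨t, ht, x, p', .inl ⟨h, rfl⟩⟩
    · cases h₁
      exact ⟨t, ht, x, p', .inr ⟨h, rfl⟩⟩
  · rintro ⟨t, ht, x, r, ⟨h, rfl⟩ | ⟨h, rfl⟩⟩
    · exact ⟨t, ht, _, h, .inl ⟨rfl, rfl⟩⟩
    · exact ⟨t, ht, _, h, .inr ⟨rfl, rfl⟩⟩

/-- Which pairs of states are derived depends on the states only, not on the stored words; this is
what `exists_mem_stage_length` asks for. -/
theorem exists_mem_commonRule [DecidableEq ι] {edges : List (Edge (ι × Bool))}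
    (L L' : List (Item (ι × Bool))) (h : ∀ x ∈ L, ∃ y ∈ L', y.1 = x.1) :
    ∀ x ∈ commonRule edges L, ∃ y ∈ commonRule edges L', y.1 = x.1 := by
  intro s hs
  obtain ⟨t, ht, x, p, q, h₁, h₂, rfl⟩ := mem_commonRule.1 hs
  obtain ⟨t', ht', htt⟩ := h t ht
  rw [← htt] at h₁ h₂
  exact ⟨_, mem_commonRule.2 ⟨t', ht', x, p, q, h₁, h₂, rfl⟩, rfl⟩

theorem exists_mem_singleRule {edges : List (Edge (ι × Bool))}
    (L L' : List (Item (ι × Bool))) (h : ∀ x ∈ L, ∃ y ∈ L', y.1 = x.1) :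
    ∀ x ∈ singleRule edges L, ∃ y ∈ singleRule edges L', y.1 = x.1 := by
  intro s hs
  obtain ⟨t, ht, x, r, hs⟩ := mem_singleRule.1 hs
  obtain ⟨t', ht', htt⟩ := h t ht
  rw [← htt] at hs
  rcases hs with ⟨h₁, rfl⟩ | ⟨h₁, rfl⟩
  · exact ⟨_, mem_singleRule.2 ⟨t', ht', x, r, .inl ⟨h₁, rfl⟩⟩, rfl⟩
  · exact ⟨_, mem_singleRule.2 ⟨t', ht', x, r, .inr ⟨h₁, rfl⟩⟩, rfl⟩

variable [DecidableEq ι] {G : Graph (ι × Bool)} {i : ℕ}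

/-- The words of an item lead from the initial states to its states. -/
def ItemReads (G : Graph (ι × Bool)) (t : Item (ι × Bool)) : Prop :=
  (∀ w, Reads G t.1.1 w → Reads G G.2.2.2.1 (t.2.1 ++ w)) ∧
    ∀ w, Reads G t.1.2 w → Reads G G.2.2.2.2 (t.2.2 ++ w)

/-- Stored words grow at the end, whereas `Reads` takes a word apart from the front. Quantifying
over all continuations reconciles the two. -/
theorem reads_of_edge {s p q : Vertex} {u w : List (ι × Bool)} {x : ι × Bool}
    (h : ∀ w, Reads G p w → Reads G s (u ++ w)) (hx : (p, x, q) ∈ Graph.longEdges flip G)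
    (hw : Reads G q w) : Reads G s ((u ++ [x]) ++ w) := by
  rw [List.append_assoc]
  exact h _ ⟨q, hx, hw⟩

theorem commonItems_spec : ∀ t ∈ Graph.commonItems flip G i,
    ItemReads G t ∧ t.2.1 = t.2.2 := by
  refine forall_mem_stage (p := fun _ (t : Item (ι × Bool)) => ItemReads G t ∧ t.2.1 = t.2.2)
    ?_ (fun _ _ h => h) ?_
  · intro t ht
    rw [List.mem_singleton] at ht
    subst ht
    exact ⟨⟨fun w h => h, fun w h => h⟩, rfl⟩
  · rintro - L hL s hs -
    obtain ⟨t, ht, x, p, q, h₁, h₂, rfl⟩ := mem_commonRule.1 hs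
    obtain ⟨⟨h₃, h₄⟩, h₅⟩ := hL t ht
    exact ⟨⟨fun w => reads_of_edge h₃ h₁, fun w => reads_of_edge h₄ h₂⟩, by simp [h₅]⟩

theorem norm_mk_singleton (x : ι × Bool) : (FreeGroup.mk [x]).norm = 1 := by
  simp [FreeGroup.norm]

/-- The common words have distance 0, and a letter appended on one side changes the distance by at
most 1. Only an inequality can hold, since stored words need not be reduced. -/
theorem items_spec : ∀ t ∈ Graph.items flip G i, ItemReads G t ∧
    ((FreeGroup.mk t.2.1)⁻¹ * FreeGroup.mk t.2.2).norm ≤ i := by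
  refine forall_mem_stage (p := fun i (t : Item (ι × Bool)) => ItemReads G t ∧
    ((FreeGroup.mk t.2.1)⁻¹ * FreeGroup.mk t.2.2).norm ≤ i)
    ?_ (fun i t h => ⟨h.1, h.2.trans (Nat.le_succ i)⟩) ?_
  · intro t ht
    obtain ⟨h₁, h₂⟩ := commonItems_spec t ht
    exact ⟨h₁, by rw [h₂, inv_mul_cancel, FreeGroup.norm_one]⟩
  · rintro i L hL s hs -
    obtain ⟨t, ht, x, r, ⟨h₁, rfl⟩ | ⟨h₁, rfl⟩⟩ := mem_singleRule.1 hs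
    all_goals
      obtain ⟨⟨h₃, h₄⟩, h₅⟩ := hL t ht
    · refine ⟨⟨fun w => reads_of_edge h₃ h₁, h₄⟩, ?_⟩
      rw [← FreeGroup.mul_mk, mul_inv_rev, mul_assoc]
      refine (FreeGroup.norm_mul_le _ _).trans ?_
      rw [FreeGroup.norm_inv_eq, norm_mk_singleton]
      dsimp only
      omega
    · refine ⟨⟨h₃, fun w => reads_of_edge h₄ h₁⟩, ?_⟩
      rw [← FreeGroup.mul_mk, ← mul_assoc]
      refine (FreeGroup.norm_mul_le _ _).trans ?_
      rw [norm_mk_singleton]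
      dsimp only
      omega

theorem mem_final {S : List (Item (ι × Bool))} {t : Item (ι × Bool)} :
    t ∈ Graph.final flip G S ↔ t ∈ S ∧ Reads G t.1.1 [] ∧ Reads G t.1.2 [] := by
  simp [Graph.final, Reads]

namespace Graph.Valid

theorem longEdges_mem (hG : Graph.Valid G) {p q : Vertex} {x : ι × Bool}
    (h : (p, x, q) ∈ Graph.longEdges flip G) : q ∈ G.1 := by
  obtain ⟨r, -, h⟩ := mem_longEdges.1 h
  exact (hG.edge _ h).2

theorem fst_mem_of_mem_commonItems (hG : Graph.Valid G) {t : Item (ι × Bool)}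
    (ht : t ∈ Graph.commonItems flip G i) : t.1 ∈ Graph.pairs G := by
  refine key_mem_of_mem_stage ?_ ht
  intro t ht
  rw [List.mem_singleton] at ht
  subst ht
  exact mem_pairs.2 hG.start

theorem fst_mem_of_mem_items (hG : Graph.Valid G) {t : Item (ι × Bool)}
    (ht : t ∈ Graph.items flip G i) : t.1 ∈ Graph.pairs G :=
  key_mem_of_mem_stage (fun _ h => hG.fst_mem_of_mem_commonItems h) ht

/-- Both sides read `c` in step. After each letter, saturation supplies an item with the right
states, possibly storing a common word other than the one read; the rests `a` and `b` can be read
all the same. -/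
theorem exists_commonItem (hG : Graph.Valid G) {a b c : List (ι × Bool)} {t : Item (ι × Bool)}
    (ht : t ∈ Graph.commonItems flip G (Graph.pairs G).length)
    (ha : Reads G t.1.1 (c ++ a)) (hb : Reads G t.1.2 (c ++ b)) :
    ∃ s ∈ Graph.commonItems flip G (Graph.pairs G).length, Reads G s.1.1 a ∧ Reads G s.1.2 b := by
  induction c generalizing t with
  | nil => exact ⟨t, ht, ha, hb⟩
  | cons x c ih =>
    obtain ⟨p, hp, ha⟩ := ha
    obtain ⟨q, hq, hb⟩ := hb
    have hS : ∀ t ∈ [(G.2.2.2, (([] : List (ι × Bool)), ([] : List (ι × Bool))))],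
        t.1 ∈ Graph.pairs G := fun t ht => hG.fst_mem_of_mem_commonItems (i := 0) ht
    obtain ⟨y, hy, hyk⟩ := exists_mem_stage_succ_of_rule (key := Prod.fst) (K := Graph.pairs G)
      (rule := commonRule (Graph.longEdges flip G)) (mem_commonRule.2 ⟨t, ht, x, p, q, hp, hq, rfl⟩)
      (mem_pairs.2 ⟨hG.longEdges_mem hp, hG.longEdges_mem hq⟩)
    obtain ⟨z, hz, hzk⟩ := exists_mem_stage_length hS exists_mem_commonRule hy
    have hz' : z.1 = (p, q) := hzk.trans hyk
    exact ih hz (by rwa [hz']) (by rwa [hz'])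

/-- Each letter costs one stage: first those of `a` on the left, then those of `b` on the right. -/
theorem exists_final_of_reads (hG : Graph.Valid G) {a b : List (ι × Bool)} {t : Item (ι × Bool)}
    (ht : t ∈ Graph.items flip G i) (ha : Reads G t.1.1 a) (hb : Reads G t.1.2 b) :
    ∃ s, s ∈ Graph.final flip G (Graph.items flip G (i + (a.length + b.length))) := by
  induction a generalizing t i with
  | nil =>
    induction b generalizing t i with
    | nil => exact ⟨t, mem_final.2 ⟨ht, ha, hb⟩⟩
    | cons x b ih =>
      obtain ⟨q, hq, hb⟩ := hb
      obtain ⟨y, hy, hyk⟩ := exists_mem_stage_succ_of_rule (key := Prod.fst) (K := Graph.pairs G)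
        (rule := singleRule (Graph.longEdges flip G))
        (mem_singleRule.2 ⟨t, ht, x, q, .inr ⟨hq, rfl⟩⟩)
        (mem_pairs.2 ⟨(mem_pairs.1 (hG.fst_mem_of_mem_items ht)).1, hG.longEdges_mem hq⟩)
      obtain ⟨s, hs⟩ := ih (t := y) hy (by rwa [hyk]) (by rwa [hyk])
      refine ⟨s, ?_⟩
      simp only [List.length_cons]
      rwa [show i + (([] : List (ι × Bool)).length + (b.length + 1)) =
        i + 1 + (([] : List (ι × Bool)).length + b.length) by omega]
  | cons x a ih =>
    obtain ⟨q, hq, ha⟩ := ha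
    obtain ⟨y, hy, hyk⟩ := exists_mem_stage_succ_of_rule (key := Prod.fst) (K := Graph.pairs G)
      (rule := singleRule (Graph.longEdges flip G))
      (mem_singleRule.2 ⟨t, ht, x, q, .inl ⟨hq, rfl⟩⟩)
      (mem_pairs.2 ⟨hG.longEdges_mem hq, (mem_pairs.1 (hG.fst_mem_of_mem_items ht)).2⟩)
    obtain ⟨s, hs⟩ := ih (t := y) hy (by rwa [hyk]) (by rwa [hyk])
    refine ⟨s, ?_⟩
    simp only [List.length_cons]
    rwa [show i + (a.length + 1 + b.length) = i + 1 + (a.length + b.length) by omega]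

/-- Elements at distance `k` are found after at most `k` steps. -/
theorem exists_final (hG : Graph.Valid G) {r s : FreeGroup ι}
    (hr : r ∈ Graph.elements G G.2.2.2.1) (hs : s ∈ Graph.elements G G.2.2.2.2) :
    ∃ t, t ∈ Graph.final flip G (Graph.items flip G (r⁻¹ * s).norm) := by
  obtain ⟨c, a, b, h₁, h₂, h⟩ := exists_common_prefix r.toWord s.toWord
    FreeGroup.isReduced_toWord FreeGroup.isReduced_toWord
  have h₃ := hG.reads_toWord hG.start.1 hr
  have h₄ := hG.reads_toWord hG.start.2 hs
  rw [FreeGroup.mk_toWord, FreeGroup.mk_toWord] at h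
  obtain ⟨t₀, ht₀, hk⟩ := exists_mem_stage_of_le (key := Prod.fst) (K := Graph.pairs G)
    (rule := commonRule (Graph.longEdges flip G))
    (fun t ht => hG.fst_mem_of_mem_commonItems (i := 0) ht)
    (Nat.zero_le (Graph.pairs G).length) (List.mem_singleton_self (G.2.2.2, ([], [])))
  obtain ⟨t, ht, ha, hb⟩ := hG.exists_commonItem (a := a) (b := b) (c := c) ht₀
    (by rw [hk, ← h₁]; exact h₃) (by rw [hk, ← h₂]; exact h₄)
  -- Stage 0 of the second search is by definition the last stage of the first one.
  have := hG.exists_final_of_reads (i := 0) ht ha hb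
  rwa [h, ← Nat.zero_add (a.length + b.length)]

/-- Acceptance depends only on the states, and these are saturated after as many rounds as there are
pairs. This justifies the range of stages in `Graph.answer`. -/
theorem exists_final_le (hG : Graph.Valid G) {t : Item (ι × Bool)}
    (ht : t ∈ Graph.final flip G (Graph.items flip G i)) :
    ∃ j ≤ (Graph.pairs G).length, ∃ s, s ∈ Graph.final flip G (Graph.items flip G j) := by
  obtain ⟨ht, h₁, h₂⟩ := mem_final.1 ht
  obtain ⟨s, hs, hst⟩ := exists_mem_stage_length
    (fun t ht => hG.fst_mem_of_mem_commonItems ht) exists_mem_singleRule ht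
  exact ⟨_, le_rfl, s, mem_final.2 ⟨hs, by rwa [hst], by rwa [hst]⟩⟩

end Graph.Valid

theorem _root_.List.exists_of_head?_flatMap_range {α : Type} {f : ℕ → List α} {n : ℕ} {a : α}
    (h : ((List.range n).flatMap f).head? = some a) :
    ∃ i < n, a ∈ f i ∧ ∀ j < i, f j = [] := by
  induction n with
  | zero => simp at h
  | succ n ih =>
    rw [List.range_succ, List.flatMap_append, List.head?_append] at h
    rcases hn : ((List.range n).flatMap f).head? with _ | b
    · rw [hn] at h
      simp only [Option.none_or, List.flatMap_singleton] at h
      refine ⟨n, n.lt_succ_self, List.mem_of_head? h, fun j hj => ?_⟩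
      rw [List.head?_eq_none_iff, List.flatMap_eq_nil_iff] at hn
      exact hn j (List.mem_range.2 hj)
    · rw [hn] at h
      obtain ⟨i, hi, h⟩ := ih (hn.trans h)
      exact ⟨i, Nat.lt_succ_of_lt hi, h⟩

theorem answer_eq_none (hG : Graph.Valid G) (h : Graph.answer flip G = none) :
    Graph.elements G G.2.2.2.1 = ∅ ∨ Graph.elements G G.2.2.2.2 = ∅ := by
  by_contra! hne
  obtain ⟨⟨r, hr⟩, ⟨s, hs⟩⟩ := hne
  obtain ⟨t, ht⟩ := hG.exists_final hr hs
  obtain ⟨j, hj, s, hs⟩ := hG.exists_final_le ht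
  rw [Graph.answer, List.head?_eq_none_iff, List.flatMap_eq_nil_iff] at h
  have := h j (List.mem_range.2 (Nat.lt_succ_of_le hj))
  rw [this] at hs
  simp at hs

/-- The stored words have distance at most the index of the first stage with a final item. Elements
at a smaller distance would produce a final item in an earlier stage. -/
theorem answer_eq_some (hG : Graph.Valid G) {t : Item (ι × Bool)}
    (h : Graph.answer flip G = some t) :
    FreeGroup.mk t.2.1 ∈ Graph.elements G G.2.2.2.1 ∧
      FreeGroup.mk t.2.2 ∈ Graph.elements G G.2.2.2.2 ∧
      ∀ r ∈ Graph.elements G G.2.2.2.1, ∀ s ∈ Graph.elements G G.2.2.2.2,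
        ((FreeGroup.mk t.2.1)⁻¹ * FreeGroup.mk t.2.2).norm ≤ (r⁻¹ * s).norm := by
  obtain ⟨i, -, ht, hlt⟩ := List.exists_of_head?_flatMap_range h
  obtain ⟨ht, h₁, h₂⟩ := mem_final.1 ht
  obtain ⟨⟨h₃, h₄⟩, hle⟩ := items_spec t ht
  refine ⟨mk_mem_elements_of_reads (by simpa using h₃ [] h₁),
    mk_mem_elements_of_reads (by simpa using h₄ [] h₂), fun r hr s hs => hle.trans ?_⟩
  by_contra! hk
  obtain ⟨t, ht⟩ := hG.exists_final hr hs
  rw [hlt _ hk] at ht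
  simp at ht

end ClosestPair

/-! ### From programs to machines -/

open TreeCode

theorem code_bits {A : Type} (l : List Bool) : (code l : LeafTree A) = TreeProgram.bitsTree l := by
  induction l with
  | nil => rfl
  | cons b l ih => exact congrArg (LeafTree.node _) ih

theorem code_leaves {A : Type} (l : List (ClosestPair.Leaf A)) :
    (code l : LeafTree A) = TreeProgram.leavesTree l := by
  induction l with
  | nil => rfl
  | cons b l ih => exact congrArg (LeafTree.node _) ih

/-- A function on strings that is computed in polynomial time by a program for trees is computed in
polynomial time by a Turing machine. -/
theorem PolyTime.nonempty_tm2ComputableInPolyTime {A : Type} [Fintype A] {α β : Type}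
    {ea : α → List Bool} {eb : β → List (Option A)} {f : α → β}
    {g : List Bool → List (ClosestPair.Leaf A)} (hg : PolyTime A g)
    (h : ∀ a, eb (f a) = g (ea a)) : Nonempty (Turing.TM2ComputableInPolyTime ea eb f) := by
  obtain ⟨P, t, ⟨p, hp⟩, ⟨q, hq⟩, hP⟩ := hg
  let Q := ((TreeProgram.readInput A).seq P).seq (TreeProgram.writeOutput A)
  -- The times for reading, computing and writing. A bit has size at most 3 and its list cell adds
  -- 1, so an input of length m has a tree of size at most 1 + 4m.
  let r : Polynomial ℕ := 2 * .X + 3 + p.comp (1 + 4 * .X) + (2 * q.comp (1 + 4 * .X) + 2)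
  have hsize : ∀ l : List Bool, TreeCode.size A l ≤ 1 + 4 * l.length := by
    intro l
    have := size_le_of_forall (A := A) (l := l) (n := 3) fun b _ => size_bool_le b
    omega
  have key : ∀ a, Nonempty (Turing.TM2OutputsInTime Q.toFinTM2 ((ea a).map id)
      (Option.some ((eb (f a)).map id)) (r.eval (ea a).length)) := by
    intro a
    suffices h : Q.Exec none (TreeProgram.store ((ea a).map id) [] [] [] [] []) none
        (TreeProgram.store [] ((eb (f a)).map id) [] [] [] []) (r.eval (ea a).length) from
      StackProgram.nonempty_tm2OutputsInTime h
    rw [List.map_id, List.map_id]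
    have h₁ := TreeProgram.exec_readInput (A := A) (ea a)
    have h₂ := hP (ea a) []
    rw [List.append_nil, List.append_nil, code_bits, code_leaves] at h₂
    have h₃ := TreeProgram.exec_writeOutput (eb (f a))
    rw [← h] at h₂
    refine (StackProgram.exec_seq (StackProgram.exec_seq h₁ h₂) h₃).mono ?_
    have h₄ := (hp (ea a)).trans (p.eval_nat_mono (hsize (ea a)))
    have h₅ := (length_le_size (A := A) (g (ea a))).trans
      ((hq (ea a)).trans (q.eval_nat_mono (hsize (ea a))))
    have h₆ : (eb (f a)).length = List.length (g (ea a)) := by rw [h]; rfl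
    simp only [r, Polynomial.eval_add, Polynomial.eval_mul, Polynomial.eval_comp,
      Polynomial.eval_X, Polynomial.eval_one, Polynomial.eval_ofNat]
    dsimp only at h₄ h₅
    omega
  exact ⟨⟨⟨Q.toFinTM2, Equiv.refl Bool, Equiv.refl (Option A)⟩, r, fun a => (key a).some⟩⟩

/-! ### The tables of automata -/

namespace ClosestPair

theorem decodeNats_encodeNats (l : List ℕ) : decodeNats (encodeNats l) = l := by
  let F : List ℕ × ℕ → Bool → List ℕ × ℕ := fun p b =>
    if b = true then (p.1, p.2 + 1) else (p.1 ++ [p.2], 0)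
  have h₁ : ∀ m r k, (List.replicate m true).foldl F (r, k) = (r, k + m) := by
    intro m
    induction m with
    | zero => simp
    | succ m ih =>
      intro r k
      rw [List.replicate_succ, List.foldl_cons]
      refine (ih r (k + 1)).trans ?_
      rw [Nat.add_right_comm, Nat.add_assoc]
  have h₂ : ∀ r, (encodeNats l).foldl F (r, 0) = (r ++ l, 0) := by
    induction l with
    | nil => simp [encodeNats]
    | cons m l ih =>
      intro r
      have : encodeNats (m :: l) = List.replicate m true ++ [false] ++ encodeNats l := rfl
      rw [this, List.foldl_append, List.foldl_append, h₁]
      refine (ih (r ++ [0 + m])).trans ?_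
      simp
  exact congrArg Prod.fst (h₂ [])

theorem _root_.List.zipRest_map {α γ δ : Type} (l : List α) (f : α → γ) (g : α → δ)
    (r : List δ) :
    (l.map f).zipRest (l.map g ++ r) = (l.map fun a => (f a, g a), r) := by
  induction l with
  | nil => simp [List.zipRest]
  | cons a l ih => simpa [List.zipRest] using ih

/-- The letters, in the order of the tables. -/
def letters (n : ℕ) : List (Fin n × Bool) :=
  (List.finRange n).flatMap fun i => [(i, true), (i, false)]

theorem mem_letters {n : ℕ} (x : Fin n × Bool) : x ∈ letters n := by
  obtain ⟨i, b⟩ := x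
  cases b <;> simp [letters]

variable {n : ℕ} (M : DetAutomaton n)

/-- An entry of the table of an automaton. -/
def entry (p : Fin M.states) : Option (Fin n × Bool) → ℕ
  | none => (M.accept p).toNat
  | some a =>
    match M.step p a with
    | none => 0
    | some q => (q : ℕ) + 1

/-- The positions in the table of an automaton. -/
def positions : List (Fin M.states × Option (Fin n × Bool)) :=
  (List.finRange M.states).flatMap fun p => (none :: (letters n).map some).map fun o => (p, o)

theorem mem_positions (p : Fin M.states) (o : Option (Fin n × Bool)) : (p, o) ∈ positions M := by
  cases o <;> simp [positions, mem_letters]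

theorem table_eq :
    M.table = M.states :: (M.start : ℕ) :: (positions M).map fun w => entry M w.1 w.2 := by
  refine congrArg (List.cons _) (congrArg (List.cons _) ?_)
  rw [positions, List.map_flatMap]
  refine congrArg (List.flatMap · _) (funext fun p => ?_)
  rw [List.map_map, List.map_cons, List.map_map]
  rfl

theorem slots_eq :
    slots (letters n) M.states = (positions M).map fun w => ((w.1 : ℕ), w.2) := by
  rw [slots, ← List.map_coe_finRange_eq_range, List.flatMap_map, positions, List.map_flatMap]
  simp [Function.comp_def]

/-- The entries of the table of an automaton, with their positions. -/
def entries : List ((ℕ × Option (Fin n × Bool)) × ℕ) :=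
  (positions M).map fun w => (((w.1 : ℕ), w.2), entry M w.1 w.2)

/-- The number of states determines the number of entries, so two tables can be written one after
the other without a separator. -/
theorem parse_table (r : List ℕ) :
    parse (letters n) (M.table ++ r) = (M.states, (M.start : ℕ), entries M, r) := by
  have : parse (letters n) (M.table ++ r) = (M.states, (M.start : ℕ),
      (slots (letters n) M.states).zipRest ((positions M).map (fun w => entry M w.1 w.2) ++ r)) := by
    rw [table_eq]; rfl
  rw [this, slots_eq, List.zipRest_map]
  rfl

theorem mem_tableEdges {t : Bool} {e : Edge (Fin n × Bool)} :
    e ∈ tableEdges t (entries M) ↔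
      ∃ p x q, M.step p x = some q ∧ e = ((t, (p : ℕ)), x, (t, (q : ℕ))) := by
  simp only [tableEdges, entries, List.mem_flatMap, List.mem_map, Option.mem_toList]
  constructor
  · rintro ⟨-, ⟨⟨p, o⟩, -, rfl⟩, x, hx, he⟩
    cases hx
    simp only [entry] at he
    rcases h : M.step p x with _ | q
    · simp [h] at he
    · simp only [h] at he
      exact ⟨p, x, q, h, by simpa using he⟩
  · rintro ⟨p, x, q, h, rfl⟩
    exact ⟨_, ⟨⟨p, some x⟩, mem_positions M _ _, rfl⟩, x, rfl, by simp [entry, h]⟩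

theorem mem_tableAccept {t : Bool} {v : Vertex} :
    v ∈ tableAccept t (entries M) ↔ ∃ p, M.accept p = true ∧ v = (t, (p : ℕ)) := by
  simp only [tableAccept, entries, List.mem_flatMap, List.mem_map, List.mem_ite_nil_right,
    List.mem_singleton]
  constructor
  · rintro ⟨-, ⟨⟨p, o⟩, -, rfl⟩, ⟨rfl, h⟩, rfl⟩
    refine ⟨p, ?_, rfl⟩
    simpa [entry] using h
  · rintro ⟨p, h, rfl⟩
    exact ⟨_, ⟨⟨p, none⟩, mem_positions M _ _, rfl⟩, ⟨rfl, by simp [entry, h]⟩, rfl⟩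

/-- Paths in the graph of an automaton. -/
theorem path_iff {edges : List (Edge (Fin n × Bool))} {t : Bool}
    (h : ∀ (p : Fin M.states) x v, ((t, (p : ℕ)), x, v) ∈ edges ↔
      ∃ q, M.step p x = some q ∧ v = (t, (q : ℕ)))
    (p : Fin M.states) (w : GroupWord n) (v : Vertex) :
    Path edges (t, (p : ℕ)) w v ↔ ∃ q, w.foldlM M.step p = some q ∧ v = (t, (q : ℕ)) := by
  induction w generalizing p with
  | nil => simp [Path, eq_comm]
  | cons x w ih =>
    simp only [Path, h, List.foldlM_cons]
    constructor
    · rintro ⟨_, ⟨q, hq, rfl⟩, hw⟩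
      obtain ⟨r, hr, rfl⟩ := (ih q).1 hw
      exact ⟨r, by simp [hq, hr], rfl⟩
    · rintro ⟨r, hr, rfl⟩
      obtain ⟨q, hq, hr⟩ := Option.bind_eq_some_iff.1 hr
      exact ⟨_, ⟨q, hq, rfl⟩, (ih q).2 ⟨r, hr, rfl⟩⟩

/-- The tag `t` separates the two automata within one graph: edges out of a state with this tag keep
the tag, so the other automaton is never entered. -/
theorem elements_eq {G : Graph (Fin n × Bool)} {t : Bool}
    (h : ∀ (p : Fin M.states) x v, ((t, (p : ℕ)), x, v) ∈ G.2.1 ↔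
      ∃ q, M.step p x = some q ∧ v = (t, (q : ℕ)))
    (h' : ∀ p : Fin M.states, (t, (p : ℕ)) ∈ G.2.2.1 ↔ M.accept p = true) :
    Graph.elements G (t, (M.start : ℕ)) = M.rationalSubset := by
  ext g
  constructor
  · rintro ⟨w, f, hf, hw, rfl⟩
    obtain ⟨q, hq, rfl⟩ := (path_iff M h _ _ _).1 hw
    exact ⟨w, ⟨q, hq, (h' q).1 hf⟩, rfl⟩
  · rintro ⟨w, ⟨q, hq, hf⟩, rfl⟩
    exact ⟨w, _, (h' q).2 hf, (path_iff M h _ _ _).2 ⟨q, hq, rfl⟩, rfl⟩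

/-- The graph of two automata. -/
def inputGraph (x : DetAutomaton n × DetAutomaton n) : Graph (Fin n × Bool) :=
  toGraph (letters n) (decodeNats (encodeInput x))

theorem inputGraph_eq (x : DetAutomaton n × DetAutomaton n) : inputGraph x =
    ((List.range x.1.states).map (fun v => (false, v)) ++
        (List.range x.2.states).map (fun v => (true, v)),
      tableEdges false (entries x.1) ++ tableEdges true (entries x.2),
      tableAccept false (entries x.1) ++ tableAccept true (entries x.2),
      (false, (x.1.start : ℕ)), (true, (x.2.start : ℕ))) := by
  rw [inputGraph, encodeInput, decodeNats_encodeNats]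
  have h := parse_table x.2 []
  rw [List.append_nil] at h
  simp only [toGraph, parse_table, h]

theorem valid_inputGraph (x : DetAutomaton n × DetAutomaton n) : Graph.Valid (inputGraph x) := by
  rw [inputGraph_eq]
  constructor
  · intro e he
    rcases List.mem_append.1 he with he | he <;>
    · obtain ⟨p, a, q, -, rfl⟩ := (mem_tableEdges _).1 he
      simp
  · simp

theorem elements_inputGraph (x : DetAutomaton n × DetAutomaton n) :
    Graph.elements (inputGraph x) (inputGraph x).2.2.2.1 = x.1.rationalSubset ∧
      Graph.elements (inputGraph x) (inputGraph x).2.2.2.2 = x.2.rationalSubset := by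
  rw [inputGraph_eq]
  refine ⟨elements_eq x.1 ?_ ?_, elements_eq x.2 ?_ ?_⟩
  · intro p a v
    rw [List.mem_append, mem_tableEdges, mem_tableEdges]
    constructor
    · rintro (⟨p', a', q, h, h'⟩ | ⟨p', a', q, h, h'⟩)
      · simp only [Prod.mk.injEq, Fin.val_inj, true_and] at h'
        obtain ⟨rfl, rfl, rfl⟩ := h'
        exact ⟨q, h, rfl⟩
      · simp at h'
    · rintro ⟨q, h, rfl⟩
      exact .inl ⟨p, a, q, h, rfl⟩
  · intro p
    simp only [List.mem_append, mem_tableAccept]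
    simp [Fin.val_inj]
  · intro p a v
    rw [List.mem_append, mem_tableEdges, mem_tableEdges]
    constructor
    · rintro (⟨p', a', q, h, h'⟩ | ⟨p', a', q, h, h'⟩)
      · simp at h'
      · simp only [Prod.mk.injEq, Fin.val_inj, true_and] at h'
        obtain ⟨rfl, rfl, rfl⟩ := h'
        exact ⟨q, h, rfl⟩
    · rintro ⟨q, h, rfl⟩
      exact .inr ⟨p, a, q, h, rfl⟩
  · intro p
    simp only [List.mem_append, mem_tableAccept]
    simp [Fin.val_inj]

end ClosestPair

open ClosestPair in
theorem mainTheorem10 (n : ℕ) :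
    SolvableInPolyTime (encodeInput (n := n)) (encodeOutput (n := n)) (IsClosestPair (n := n)) := by
  refine ⟨fun x => (Graph.answer ClosestPair.flip (inputGraph x)).map Prod.snd, fun x => ?_, ?_⟩
  · obtain ⟨h₁, h₂⟩ := elements_inputGraph x
    rcases h : Graph.answer ClosestPair.flip (inputGraph x) with _ | t
    · dsimp only
      rw [h, Option.map_none, IsClosestPair, ← h₁, ← h₂]
      exact answer_eq_none (valid_inputGraph x) h
    · dsimp only
      rw [h, Option.map_some]
      simp only [IsClosestPair, ← h₁, ← h₂]
      exact answer_eq_some (valid_inputGraph x) h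
  -- The machine works on bit strings; its function is defined for every string and matters only on
  -- encodings of pairs of automata.
  · have hg : PolyTime (Fin n × Bool) fun l : List Bool => outputLeaves
        (Graph.answer ClosestPair.flip (toGraph (letters n) (decodeNats l))) :=
      polyTime_outputLeaves.comp ((polyTime_answer _).comp
        ((polyTime_toGraph (letters n)).comp polyTime_decodeNats))
    refine hg.nonempty_tm2ComputableInPolyTime fun x => ?_
    change _ = outputString (Graph.answer ClosestPair.flip (inputGraph x))
    rcases Graph.answer ClosestPair.flip (inputGraph x) with _ | ⟨k, u, v⟩ <;>
      simp [outputString, encodeOutput]
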